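/- Let $n\ge 1$, let $S^{n-1}$ be the unit sphere of $\mathbb{R}^n$, and let $du$ denote integration with respect to spherical Lebesgue measure $\mathcal{H}^{n-1}$ on $S^{n-1}$. For a convex body $K\subset\mathbb{R}^n$ containing the origin $o$ in its interior and $u\in S^{n-1}$, let $h_K(u)=\max\{\langle u,x\rangle:x\in K\}$, $\rho_K(u)=\max\{r\ge 0: ru\in K\}$, let $\alpha_K(u)$ be the (for almost all $u$ unique) outer unit normal vector of $K$ at the boundary point $\rho_K(u)u$, and for $E\subset S^{n-1}$ let $\boldsymbol{\alpha}^*_K(E)$ be the set of all $u\in S^{n-1}$ such that some vector of $E$ is an outer unit normal vector of $K$ at $\rho_K(u)u$. For $G:(0,\infty)\times S^{n-1}\to(0,\infty)$ with partial derivative $G_t=\partial G/\partial t$ and $\psi:(0,\infty)\to(0,\infty)$, put $$\widetilde V_G(K)=\int_{S^{n-1}}G(\rho_K(u),u)\,du,\qquad \widetilde C_{G,\psi}(K,E)=\frac1n\int_{\boldsymbol{\alpha}^*_K(E)}\frac{\rho_K(u)\,G_t(\rho_K(u),u)}{\psi(h_K(\alpha_K(u)))}\,du$$ for Borel sets $E\subset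 S^{n-1}$, and write $\widetilde C_G=\widetilde C_{G,1}$. Let $\varphi(t)=\int_0^t\frac{\psi(s)}{s}\,ds$ for $t>0$, $\varphi(0)=0$, and, for a nonzero finite Borel measure $\mu$ on $S^{n-1}$, $$\|h_K\|_{\varphi,\mu}=\inf\Big\{\lambda>0:\frac{1}{\varphi(1)\,\mu(S^{n-1})}\int_{S^{n-1}}\varphi\Big(\frac{h_K(u)}{\lambda}\Big)\,d\mu(u)\le 1\Big\}.$$ **Theorem.** Let $\mu=\sum_{i=1}^m\lambda_i\delta_{u_i}$, where $\lambda_i>0$ for $i=1,\dots,m$ and $\{u_1,\dots,u_m\}\subset S^{n-1}$ is not contained in a closed hemisphere. Let $G:(0,\infty)\times S^{n-1}\to(0,\infty)$ be continuous and such that $G_t$ exists and is continuous and negative on $(0,\infty)\times S^{n-1}$. Let $0<\varepsilon_0<1$ and suppose that for every $v\in S^{n-1}$ $$\lim_{t\to0+}\int_{\{u\in S^{n-1}:\langle u,v\rangle\ge\varepsilon_0\}}G(t,u)\,du=\infty .$$ Let $\psi:(0,\infty)\to(0,\infty)$ be continuous with $\int_1^\infty\frac{\psi(s)}{s}\,ds=\infty$,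 and suppose that $\varphi$ is finite on $(0,\infty)$. Then there exist a convex polytope $P$ containing $o$ in its interior and a real number $\tau<0$ such that $$\mu=\tau\,\widetilde C_{G,\psi}(P,\cdot)\qquad\text{and}\qquad \|h_P\|_{\varphi,\mu}=1,$$ where $$\tau=\frac{\mu(S^{n-1})}{\widetilde C_{G,\psi}(P,S^{n-1})}=\frac{1}{\widetilde C_G(P,S^{n-1})}\int_{S^{n-1}}\psi(h_P(u))\,d\mu(u).$$ Moreover, $P$ can be chosen to be of the form $P=P(z^0)$, where $P(z)=\{x\in\mathbb{R}^n:\langle x,u_i\rangle\le z_i,\ i=1,\dots,m\}$ and $z^0$ minimizes $\widetilde V_G(P(z))$ among all $z\in(0,\infty)^m$ with $\sum_{i=1}^m\lambda_i\varphi(z_i)=\sum_{i=1}^m\lambda_i\varphi(1)$. -/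

import Mathlib

open MeasureTheory Set Filter Topology

noncomputable section

namespace DualOrlicz

/-- Euclidean space `ℝⁿ`. -/
abbrev Eu (n : ℕ) := EuclideanSpace ℝ (Fin n)

/-- The unit sphere `S^{n-1}` of `ℝⁿ`. -/
abbrev Sph (n : ℕ) := Metric.sphere (0 : Eu n) 1

/-- Spherical Lebesgue measure `du` on `S^{n-1}`, of total mass `n κ_n`, that is, the
`(n-1)`-dimensional Hausdorff measure in its usual normalization. -/
def sphMeas (n : ℕ) : Measure (Sph n) := (volume : Measure (Eu n)).toSphere

/-- `K` is a convex body that contains the origin in its interior. -/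
def IsBodyAroundOrigin {n : ℕ} (K : Set (Eu n)) : Prop :=
  Convex ℝ K ∧ IsCompact K ∧ (0 : Eu n) ∈ interior K

/-- A convex polytope is the convex hull of a finite set. -/
def IsConvexPolytope {n : ℕ} (K : Set (Eu n)) : Prop :=
  ∃ F : Set (Eu n), F.Finite ∧ K = convexHull ℝ F

/-- The closed hemisphere of `S^{n-1}` centred at `v`. -/
def closedHemisphere {n : ℕ} (v : Sph n) : Set (Sph n) :=
  {u | 0 ≤ inner ℝ (u : Eu n) (v : Eu n)}

/-- The spherical cap `Σ_ε(v) = {u ∈ S^{n-1} : ⟨u, v⟩ ≥ ε}`. -/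
def cap {n : ℕ} (ε : ℝ) (v : Sph n) : Set (Sph n) :=
  {u | ε ≤ inner ℝ (u : Eu n) (v : Eu n)}

/-- The support function `h_K(u) = max {⟨u, x⟩ : x ∈ K}` on the sphere. -/
def supportFn {n : ℕ} (K : Set (Eu n)) (u : Sph n) : ℝ :=
  sSup ((fun x : Eu n => inner ℝ (u : Eu n) x) '' K)

/-- The radial function `ρ_K(u) = max {r ≥ 0 : r u ∈ K}` on the sphere. -/
def radialFn {n : ℕ} (K : Set (Eu n)) (u : Sph n) : ℝ :=
  sSup {r : ℝ | 0 ≤ r ∧ r • (u : Eu n) ∈ K}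

/-- The radial map `r_K(u) = ρ_K(u) u`. -/
def radialMap {n : ℕ} (K : Set (Eu n)) (u : Sph n) : Eu n :=
  radialFn K u • (u : Eu n)

/-- The normal cone `N(K, z)`. -/
def normalCone {n : ℕ} (K : Set (Eu n)) (z : Eu n) : Set (Eu n) :=
  {y | ∀ x ∈ K, inner ℝ y (x - z) ≤ 0}

/-- The reverse spherical image `ν_K⁻¹(E) = {x ∈ ∂K : N(K, x) ∩ E ≠ ∅}`. -/
def revSphericalImage {n : ℕ} (K : Set (Eu n)) (E : Set (Sph n)) : Set (Eu n) :=
  {x | x ∈ frontier K ∧ ∃ v ∈ E, (v : Eu n) ∈ normalCone K x}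

/-- The reverse radial spherical image `α*_K(E) = r_K⁻¹(ν_K⁻¹(E))`. -/
def revRadialSphericalImage {n : ℕ} (K : Set (Eu n)) (E : Set (Sph n)) : Set (Sph n) :=
  radialMap K ⁻¹' revSphericalImage K E

open Classical in
/-- The radial Gauss map `α_K`: `α_K(u)` is the outer unit normal vector of `K` at `r_K(u)`.
For a convex body around the origin this vector is unique for almost all `u`; on the
exceptional null set some outer unit normal vector is chosen. -/
def radialGaussMap {n : ℕ} (K : Set (Eu n)) (u : Sph n) : Sph n :=
  if h : ∃ v : Sph n, (v : Eu n) ∈ normalCone K (radialMap K u) then h.choose else u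

/-- The general dual volume `Ṽ_G(K) = ∫ G(ρ_K(u), u) du`. -/
def dualVolume {n : ℕ} (G : ℝ → Sph n → ℝ) (K : Set (Eu n)) : ℝ :=
  ∫ u, G (radialFn K u) u ∂(sphMeas n)

/-- The partial derivative `G_t(t, u) = ∂G(t, u)/∂t`. -/
def partialT {n : ℕ} (G : ℝ → Sph n → ℝ) (t : ℝ) (u : Sph n) : ℝ :=
  deriv (fun s => G s u) t

/-- The general dual Orlicz curvature measure
`C̃_{G,ψ}(K, E) = (1/n) ∫_{α*_K(E)} ρ_K(u) G_t(ρ_K(u), u) / ψ(h_K(α_K(u))) du`. -/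
def curvMeas {n : ℕ} (G : ℝ → Sph n → ℝ) (ψ : ℝ → ℝ) (K : Set (Eu n)) (E : Set (Sph n)) : ℝ :=
  (1 / (n : ℝ)) * ∫ u in revRadialSphericalImage K E,
    radialFn K u * partialT G (radialFn K u) u / ψ (supportFn K (radialGaussMap K u)) ∂(sphMeas n)

/-- The function `φ(t) = ∫_0^t ψ(s)/s ds` for `t ≥ 0` (used only where it is finite). -/
def phi (ψ : ℝ → ℝ) (t : ℝ) : ℝ := ∫ s in (0 : ℝ)..t, ψ s / s

/-- The Orlicz (Luxemburg) functional
`‖h‖_{φ,μ} = inf {l > 0 : (1/(φ(1) μ(S^{n-1}))) ∫ φ(h(u)/l) dμ(u) ≤ 1}`. -/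
def orliczNorm {n : ℕ} (φ : ℝ → ℝ) (μ : Measure (Sph n)) (h : Sph n → ℝ) : ℝ :=
  sInf {l : ℝ | 0 < l ∧ 1 / (φ 1 * μ.real univ) * ∫ u, φ (h u / l) ∂μ ≤ 1}

/-- `P(z) = {x : ⟨x, u_i⟩ ≤ z_i for all i}`. -/
def polyOf {n m : ℕ} (u : Fin m → Sph n) (z : Fin m → ℝ) : Set (Eu n) :=
  {x | ∀ i, inner ℝ x (u i : Eu n) ≤ z i}

/-- The constraint set of all `z ∈ (0,∞)^m` with `∑ λ_i φ(z_i) = ∑ λ_i φ(1)`. -/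
def constraintSet {m : ℕ} (φ : ℝ → ℝ) (lam : Fin m → ℝ) : Set (Fin m → ℝ) :=
  {z | (∀ i, 0 < z i) ∧ ∑ i, lam i * φ (z i) = ∑ i, lam i * φ 1}

end DualOrlicz

end

open DualOrlicz

/-!
The polytope is found by minimizing `z ↦ dualVolume G (polyOf u z)` over the constraint set, and
the theorem is the Euler–Lagrange equation of this problem.

The radial function of `polyOf u z` is `w ↦ (max_i ⟨w, u_i⟩ / z_i)⁻¹` (`facetGauge`,
`radialFn_polyOf`). It is jointly continuous in `(z, w)` for `z > 0`, and so the dual volume is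
continuous in `z`. The constraint set is bounded because `φ` is unbounded. If some `z_i` tends to
`0`, then the radial function tends to `0` uniformly on the cap around `u_i`, and the blow-up
hypothesis on `G` makes the dual volume tend to infinity (`setIntegral_cap_le_dualVolume`). Hence a
minimizer exists (`exists_dualVolume_minimizer`).

For `∑ λ_i d_i = 0` the curve `z_i(s) = φ⁻¹(φ(z_i) + s d_i)` stays in the constraint set. For
almost every direction `w` all facets met by the ray through `w` have the same outer normal `α(w)`
(`ae_facetCone_unique`). If `d_i = c(w)` for those facets, then `log ρ` has the derivative
`c(w) / ψ(h_P(α(w)))` along the curve. The gauge is Lipschitz in the reciprocals of the `z_i`,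
uniformly in `w`, so one may differentiate under the integral sign
(`hasDerivAt_dualVolume_polyOf`), and minimality gives `∫ c g = 0`, where
`g = ρ G_t(ρ, ·) / ψ(h_P ∘ α)` is the density of the curvature measure
(`integral_eq_zero_of_minimizer`). Two choices of `d` finish the argument. With
`d_i = f(u_i) - mean` one finds that the image of `g du` under `α` is proportional to `μ`
(`integral_comp_radialGaussMap_of_minimizer`); the functions `f = 1_E` and `f = ψ ∘ h_P` give the
measure identity and the second formula for `τ`. For a redundant constraint `i` the choice
`d = (λ_i / ∑ λ_j) (1, …, 1) - e_i` yields a contradiction to `g < 0`, so that `h_P(u_i) = z_i` for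
all `i`
(`supportFn_polyOf_of_minimizer`), even if some of the `u_i` coincide; this gives the
normalization of the Orlicz norm.
-/

namespace DualOrlicz

/-! ### The gauge of a polytope given by its facets -/

/-- The function `w ↦ max_i y_i ⟨w, u_i⟩`. For `y_i = 1 / z_i` it is the gauge of the polytope
`polyOf u z`, so that its reciprocal is the radial function. -/
noncomputable def facetGauge {n m : ℕ} [Nonempty (Fin m)] (u : Fin m → Sph n)
    (y : Fin m → ℝ) (w : Sph n) : ℝ :=
  Finset.univ.sup' Finset.univ_nonempty fun i => y i * inner ℝ (w : Eu n) (u i : Eu n)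

section Gauge

variable {n m : ℕ} [Nonempty (Fin m)] {u : Fin m → Sph n}

theorem facetGauge_le_iff {y : Fin m → ℝ} {w : Sph n} {r : ℝ} :
    facetGauge u y w ≤ r ↔ ∀ i, y i * inner ℝ (w : Eu n) (u i : Eu n) ≤ r := by
  simp [facetGauge]

theorem le_facetGauge (y : Fin m → ℝ) (w : Sph n) (i : Fin m) :
    y i * inner ℝ (w : Eu n) (u i : Eu n) ≤ facetGauge u y w :=
  facetGauge_le_iff.1 le_rfl i

theorem exists_eq_facetGauge (y : Fin m → ℝ) (w : Sph n) :
    ∃ i, y i * inner ℝ (w : Eu n) (u i : Eu n) = facetGauge u y w := by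
  obtain ⟨i, -, hi⟩ := Finset.exists_mem_eq_sup' (Finset.univ_nonempty (α := Fin m))
    fun i => y i * inner ℝ (w : Eu n) (u i : Eu n)
  exact ⟨i, hi.symm⟩

theorem continuous_facetGauge :
    Continuous fun p : (Fin m → ℝ) × Sph n => facetGauge u p.1 p.2 := by
  unfold facetGauge
  refine Continuous.finset_sup'_apply _ fun i _ => ?_
  fun_prop

theorem facetGauge_pos (hu : ∀ v : Sph n, ∃ i, 0 < inner ℝ (v : Eu n) (u i : Eu n))
    {y : Fin m → ℝ} (hy : ∀ i, 0 < y i) (w : Sph n) : 0 < facetGauge u y w := by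
  obtain ⟨i, hi⟩ := hu w
  exact (mul_pos (hy i) hi).trans_le (le_facetGauge y w i)

theorem abs_inner_sphere_le (v w : Sph n) : |inner ℝ (v : Eu n) (w : Eu n)| ≤ 1 := by
  simpa using abs_real_inner_le_norm (v : Eu n) (w : Eu n)

theorem facetGauge_le_add (y y' : Fin m → ℝ) (w : Sph n) :
    facetGauge u y w ≤ facetGauge u y' w + dist y y' := by
  refine facetGauge_le_iff.2 fun i => ?_
  have h1 := le_facetGauge (u := u) y' w i
  have h2 : (y i - y' i) * inner ℝ (w : Eu n) (u i : Eu n) ≤ dist y y' := by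
    refine (le_abs_self _).trans ?_
    rw [abs_mul]
    have h3 : |y i - y' i| ≤ dist y y' := by
      rw [← Real.dist_eq]; exact dist_le_pi_dist y y' i
    calc _ ≤ |y i - y' i| * 1 := by gcongr; exact abs_inner_sphere_le w (u i)
      _ ≤ _ := by simpa using h3
  linarith [sub_mul (y i) (y' i) (inner ℝ (w : Eu n) (u i : Eu n))]

theorem abs_facetGauge_sub_le (y y' : Fin m → ℝ) (w : Sph n) :
    |facetGauge u y w - facetGauge u y' w| ≤ dist y y' := by
  have h1 := facetGauge_le_add (u := u) y y' w
  have h2 := facetGauge_le_add (u := u) y' y w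
  rw [dist_comm] at h2
  exact abs_le.2 ⟨by linarith, by linarith⟩

theorem exists_facetGauge_bounds (hu : ∀ v : Sph n, ∃ i, 0 < inner ℝ (v : Eu n) (u i : Eu n))
    {δ : ℝ} (hδ : 0 < δ) (M : ℝ) :
    ∃ a b : ℝ, 0 < a ∧ ∀ y ∈ Icc (fun _ : Fin m => δ) (fun _ => M), ∀ w,
      facetGauge u y w ∈ Icc a b := by
  have hc : IsCompact (Icc (fun _ : Fin m => δ) (fun _ => M) ×ˢ (univ : Set (Sph n))) :=
    isCompact_Icc.prod isCompact_univ
  obtain ⟨a, ha, ha'⟩ := hc.exists_forall_le' (continuous_facetGauge (u := u)).continuousOn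
    (a := 0) fun p hp => facetGauge_pos hu (fun i => hδ.trans_le (hp.1.1 i)) p.2
  obtain ⟨b, hb⟩ := (hc.image (continuous_facetGauge (u := u))).bddAbove
  exact ⟨a, b, ha, fun y hy w => ⟨ha' (y, w) ⟨hy, mem_univ _⟩,
    hb ⟨(y, w), ⟨hy, mem_univ _⟩, rfl⟩⟩⟩

end Gauge

/-- A maximum of finitely many functions is differentiable at a point as soon as all functions
attaining the maximum there have the same derivative. -/
theorem hasDerivAt_finset_sup' {ι : Type*} {s : Finset ι} (hs : s.Nonempty) {f : ι → ℝ → ℝ}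
    {x D : ℝ} (hc : ∀ i ∈ s, ContinuousAt (f i) x)
    (hD : ∀ i ∈ s, f i x = s.sup' hs (fun j => f j x) → HasDerivAt (f i) D x) :
    HasDerivAt (fun t => s.sup' hs fun i => f i t) D x := by
  set M := s.sup' hs (fun j => f j x) with hM
  obtain ⟨i₀, hi₀, h₀⟩ := Finset.exists_mem_eq_sup' hs fun j => f j x
  rw [hasDerivAt_iff_isLittleO, Asymptotics.isLittleO_iff]
  intro ε hε
  have hupper : ∀ i ∈ s, ∀ᶠ t in 𝓝 x, f i t ≤ M + (t - x) * D + ε * |t - x| := by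
    intro i hi
    by_cases hact : f i x = M
    · have := hD i hi hact
      rw [hasDerivAt_iff_isLittleO, Asymptotics.isLittleO_iff] at this
      filter_upwards [this hε] with t ht
      rw [Real.norm_eq_abs, Real.norm_eq_abs, smul_eq_mul, hact] at ht
      linarith [(abs_le.1 ht).2]
    · have hlt : f i x < M := lt_of_le_of_ne (Finset.le_sup' (fun j => f j x) hi) hact
      have h1 : ContinuousAt (fun t => M + (t - x) * D + ε * |t - x|) x := by fun_prop
      have h2 := (hc i hi).eventually_lt h1 (by simpa using hlt)
      exact h2.mono fun t ht => ht.le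
  have hlower : ∀ᶠ t in 𝓝 x, M + (t - x) * D - ε * |t - x| ≤ f i₀ t := by
    have := hD i₀ hi₀ h₀.symm
    rw [hasDerivAt_iff_isLittleO, Asymptotics.isLittleO_iff] at this
    filter_upwards [this hε] with t ht
    rw [Real.norm_eq_abs, Real.norm_eq_abs, smul_eq_mul, ← h₀] at ht
    linarith [(abs_le.1 ht).1]
  filter_upwards [(Finset.eventually_all s).2 hupper, hlower] with t h1 h2
  rw [Real.norm_eq_abs, Real.norm_eq_abs, smul_eq_mul]
  have h3 : s.sup' hs (fun i => f i t) ≤ M + (t - x) * D + ε * |t - x| := Finset.sup'_le _ _ h1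
  have h4 : f i₀ t ≤ s.sup' hs (fun i => f i t) := Finset.le_sup' (fun i => f i t) hi₀
  exact abs_le.2 ⟨by linarith, by linarith⟩

/-! ### The function `φ` and the constraint -/

section Phi

variable {ψ : ℝ → ℝ}

theorem intervalIntegrable_div_id (hψpos : ∀ t, 0 < t → 0 < ψ t)
    (hψcont : ContinuousOn ψ (Ioi 0))
    (hφfin : ∀ t, 0 < t → ∫⁻ s in Ioc (0 : ℝ) t, ENNReal.ofReal (ψ s / s) < ⊤)
    {t : ℝ} (ht : 0 ≤ t) : IntervalIntegrable (fun s => ψ s / s) volume 0 t := by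
  rcases ht.eq_or_lt with rfl | ht
  · exact IntervalIntegrable.refl
  rw [intervalIntegrable_iff_integrableOn_Ioc_of_le ht.le]
  have hc : ContinuousOn (fun s => ψ s / s) (Ioc 0 t) :=
    (hψcont.mono Ioc_subset_Ioi_self).div continuousOn_id fun s hs => hs.1.ne'
  refine ⟨hc.aestronglyMeasurable measurableSet_Ioc, ?_⟩
  rw [hasFiniteIntegral_iff_ofReal]
  · exact hφfin t ht
  · filter_upwards [ae_restrict_mem measurableSet_Ioc] with s hs
    exact (div_pos (hψpos s hs.1) hs.1).le

theorem hasStrictDerivAt_phi (hψpos : ∀ t, 0 < t → 0 < ψ t)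
    (hψcont : ContinuousOn ψ (Ioi 0))
    (hφfin : ∀ t, 0 < t → ∫⁻ s in Ioc (0 : ℝ) t, ENNReal.ofReal (ψ s / s) < ⊤)
    {t : ℝ} (ht : 0 < t) : HasStrictDerivAt (phi ψ) (ψ t / t) t := by
  have hc : ContinuousOn (fun s => ψ s / s) (Ioi 0) :=
    hψcont.div continuousOn_id fun s hs => (mem_Ioi.1 hs).ne'
  exact intervalIntegral.integral_hasStrictDerivAt_right
    (intervalIntegrable_div_id hψpos hψcont hφfin ht.le)
    (hc.stronglyMeasurableAtFilter isOpen_Ioi t ht) (hc.continuousAt (Ioi_mem_nhds ht))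

theorem continuousOn_phi (hψpos : ∀ t, 0 < t → 0 < ψ t)
    (hψcont : ContinuousOn ψ (Ioi 0))
    (hφfin : ∀ t, 0 < t → ∫⁻ s in Ioc (0 : ℝ) t, ENNReal.ofReal (ψ s / s) < ⊤) :
    ContinuousOn (phi ψ) (Ioi 0) := fun _ ht =>
  (hasStrictDerivAt_phi hψpos hψcont hφfin ht).hasDerivAt.continuousAt.continuousWithinAt

theorem strictMonoOn_phi (hψpos : ∀ t, 0 < t → 0 < ψ t)
    (hψcont : ContinuousOn ψ (Ioi 0))
    (hφfin : ∀ t, 0 < t → ∫⁻ s in Ioc (0 : ℝ) t, ENNReal.ofReal (ψ s / s) < ⊤) :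
    StrictMonoOn (phi ψ) (Ioi 0) := by
  refine strictMonoOn_of_deriv_pos (convex_Ioi 0) (continuousOn_phi hψpos hψcont hφfin) ?_
  intro t ht
  rw [interior_Ioi] at ht
  rw [(hasStrictDerivAt_phi hψpos hψcont hφfin ht).hasDerivAt.deriv]
  exact div_pos (hψpos t ht) ht

theorem phi_pos (hψpos : ∀ t, 0 < t → 0 < ψ t)
    (hψcont : ContinuousOn ψ (Ioi 0))
    (hφfin : ∀ t, 0 < t → ∫⁻ s in Ioc (0 : ℝ) t, ENNReal.ofReal (ψ s / s) < ⊤)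
    {t : ℝ} (ht : 0 < t) : 0 < phi ψ t :=
  intervalIntegral.intervalIntegral_pos_of_pos_on
    (intervalIntegrable_div_id hψpos hψcont hφfin ht.le)
    (fun s hs => div_pos (hψpos s hs.1) hs.1) ht

theorem exists_lt_phi (hψpos : ∀ t, 0 < t → 0 < ψ t)
    (hψcont : ContinuousOn ψ (Ioi 0))
    (hψinf : ∫⁻ s in Ioi (1 : ℝ), ENNReal.ofReal (ψ s / s) = ⊤)
    (hφfin : ∀ t, 0 < t → ∫⁻ s in Ioc (0 : ℝ) t, ENNReal.ofReal (ψ s / s) < ⊤)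
    (C : ℝ) : ∃ T, 0 < T ∧ C < phi ψ T := by
  by_contra! hC
  have hint : IntegrableOn (fun s => ψ s / s) (Ioi 1) := by
    refine integrableOn_Ioi_of_intervalIntegral_norm_bounded (l := atTop) (b := fun t : ℝ => t)
      C 1 (fun t => ?_) tendsto_id ?_
    · rcases le_total t 1 with h | h
      · simp [Ioc_eq_empty_of_le h]
      · exact ((intervalIntegrable_iff_integrableOn_Ioc_of_le (zero_le_one.trans h)).1
          (intervalIntegrable_div_id hψpos hψcont hφfin (zero_le_one.trans h))).mono_set
          (Ioc_subset_Ioc_left zero_le_one)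
    · filter_upwards [eventually_ge_atTop 1] with t ht
      have h0 : (0 : ℝ) < t := zero_lt_one.trans_le ht
      have h1 := intervalIntegrable_div_id hψpos hψcont hφfin zero_le_one
      have h2 := intervalIntegrable_div_id hψpos hψcont hφfin h0.le
      have h3 : ∫ s in (1 : ℝ)..t, ‖ψ s / s‖ = ∫ s in (1 : ℝ)..t, ψ s / s := by
        refine intervalIntegral.integral_congr fun s hs => ?_
        rw [uIcc_of_le ht] at hs
        have hs0 := zero_lt_one.trans_le hs.1
        exact Real.norm_of_nonneg (div_pos (hψpos s hs0) hs0).le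
      have h4 := intervalIntegral.integral_add_adjacent_intervals h1 (h1.symm.trans h2)
      have h5 := hC t h0
      have h6 := phi_pos hψpos hψcont hφfin one_pos
      simp only [phi] at h5 h6
      rw [h3]; linarith
  have h := hint.2
  rw [hasFiniteIntegral_iff_ofReal] at h
  · exact h.ne hψinf
  · filter_upwards [ae_restrict_mem measurableSet_Ioi] with s hs
    have hs0 := zero_lt_one.trans (mem_Ioi.1 hs)
    exact (div_pos (hψpos s hs0) hs0).le

theorem exists_constraintSet_le {m : ℕ} {lam : Fin m → ℝ} (hlam : ∀ i, 0 < lam i)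
    (hψpos : ∀ t, 0 < t → 0 < ψ t) (hψcont : ContinuousOn ψ (Ioi 0))
    (hψinf : ∫⁻ s in Ioi (1 : ℝ), ENNReal.ofReal (ψ s / s) = ⊤)
    (hφfin : ∀ t, 0 < t → ∫⁻ s in Ioc (0 : ℝ) t, ENNReal.ofReal (ψ s / s) < ⊤) :
    ∃ M, 0 < M ∧ ∀ z ∈ constraintSet (phi ψ) lam, ∀ i, z i ≤ M := by
  obtain ⟨M, hM⟩ : ∃ M, 0 < M ∧ ∀ i, (∑ j, lam j * phi ψ 1) / lam i < phi ψ M := by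
    choose T hT0 hT using fun i => exists_lt_phi hψpos hψcont hψinf hφfin
      ((∑ j, lam j * phi ψ 1) / lam i)
    obtain ⟨M, hM⟩ := (finite_range T).bddAbove
    have hle : ∀ i, T i ≤ max M 1 := fun i => (hM ⟨i, rfl⟩).trans (le_max_left _ _)
    refine ⟨max M 1, by positivity, fun i => (hT i).trans_le ?_⟩
    exact (strictMonoOn_phi hψpos hψcont hφfin).monotoneOn (hT0 i)
      ((hT0 i).trans_le (hle i)) (hle i)
  refine ⟨M, hM.1, fun z hz i => ?_⟩
  by_contra! h
  have h1 : lam i * phi ψ (z i) ≤ ∑ j, lam j * phi ψ 1 := by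
    rw [← hz.2]
    exact Finset.single_le_sum (f := fun j => lam j * phi ψ (z j))
      (fun j _ => (mul_pos (hlam j) (phi_pos hψpos hψcont hφfin (hz.1 j))).le)
      (Finset.mem_univ i)
  have h2 := strictMonoOn_phi hψpos hψcont hφfin hM.1 (hM.1.trans h) h
  have h3 := (div_lt_iff₀' (hlam i)).1 (hM.2 i)
  nlinarith [hlam i]

/-- Moving `φ(z_i)` linearly gives a curve inside the constraint set. It is strictly
differentiable at `0`. -/
theorem exists_constraintSet_curve {m : ℕ} {lam : Fin m → ℝ}
    (hψpos : ∀ t, 0 < t → 0 < ψ t) (hψcont : ContinuousOn ψ (Ioi 0))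
    (hφfin : ∀ t, 0 < t → ∫⁻ s in Ioc (0 : ℝ) t, ENNReal.ofReal (ψ s / s) < ⊤)
    {z : Fin m → ℝ} (hz : z ∈ constraintSet (phi ψ) lam) {d : Fin m → ℝ}
    (hd : ∑ i, lam i * d i = 0) :
    ∃ ζ : ℝ → Fin m → ℝ, ζ 0 = z ∧ (∀ᶠ s in 𝓝 0, ζ s ∈ constraintSet (phi ψ) lam) ∧
      ∀ i, HasStrictDerivAt (fun s => ζ s i) (d i * (z i / ψ (z i))) 0 := by
  have hder := fun i => hasStrictDerivAt_phi hψpos hψcont hφfin (hz.1 i)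
  have hne : ∀ i, ψ (z i) / z i ≠ 0 := fun i => (div_pos (hψpos _ (hz.1 i)) (hz.1 i)).ne'
  have hinv := fun i => (hder i).to_localInverse (hne i)
  have hline : ∀ i, HasStrictDerivAt (fun s : ℝ => phi ψ (z i) + s * d i) (d i) 0 := fun i => by
    simpa using ((hasStrictDerivAt_id (0 : ℝ)).mul_const (d i)).const_add (phi ψ (z i))
  have h0 : ∀ i, phi ψ (z i) = phi ψ (z i) + 0 * d i := fun i => by simp
  have hζ : ∀ i, HasStrictDerivAt (fun s : ℝ => (hder i).localInverse _ _ _ (hne i)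
      (phi ψ (z i) + s * d i)) (d i * (z i / ψ (z i))) 0 := fun i => by
    have := HasStrictDerivAt.comp (0 : ℝ) (h₂ := (hder i).localInverse _ _ _ (hne i))
      (by rw [← h0 i]; exact hinv i) (hline i)
    rw [inv_div, mul_comm] at this
    exact this
  have hval : ∀ i, (hder i).localInverse _ _ _ (hne i) (phi ψ (z i) + 0 * d i) = z i := fun i => by
    rw [← h0 i]
    exact HasStrictFDerivAt.localInverse_apply_image _
  refine ⟨fun s i => (hder i).localInverse _ _ _ (hne i) (phi ψ (z i) + s * d i),
    funext hval, ?_, hζ⟩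
  have hpos : ∀ᶠ s in 𝓝 (0 : ℝ), ∀ i,
      0 < (hder i).localInverse _ _ _ (hne i) (phi ψ (z i) + s * d i) := by
    refine eventually_all.2 fun i => (hζ i).hasDerivAt.continuousAt.eventually_const_lt ?_
    exact (hz.1 i).trans_eq (hval i).symm
  have hright : ∀ᶠ s in 𝓝 (0 : ℝ), ∀ i,
      phi ψ ((hder i).localInverse _ _ _ (hne i) (phi ψ (z i) + s * d i))
        = phi ψ (z i) + s * d i := by
    refine eventually_all.2 fun i => ?_
    have hc : Tendsto (fun s : ℝ => phi ψ (z i) + s * d i) (𝓝 0) (𝓝 (phi ψ (z i))) := by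
      simpa using (hline i).hasDerivAt.continuousAt.tendsto
    exact hc.eventually ((hder i).eventually_right_inverse (hne i))
  filter_upwards [hpos, hright] with s hs1 hs2
  refine ⟨hs1, ?_⟩
  calc _ = ∑ i, (lam i * phi ψ (z i) + s * (lam i * d i)) := by
        refine Finset.sum_congr rfl fun i _ => ?_
        rw [hs2 i]; ring
    _ = _ := by rw [Finset.sum_add_distrib, ← Finset.mul_sum, hd, hz.2, mul_zero, add_zero]

end Phi

/-! ### Normals, support function and vertices of a polytope -/

/-- The directions in which the ray from the origin leaves `polyOf u z` through the `i`-th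
facet, that is, in which the maximum defining the gauge is attained at the index `i`. -/
def facetCone {n m : ℕ} [Nonempty (Fin m)] (u : Fin m → Sph n) (z : Fin m → ℝ) (i : Fin m) :
    Set (Sph n) :=
  {w | (z i)⁻¹ * inner ℝ (w : Eu n) (u i : Eu n) = facetGauge u z⁻¹ w}

instance (n : ℕ) : IsFiniteMeasure (sphMeas n) := by unfold sphMeas; infer_instance

open scoped Pointwise in
theorem sphMeas_hyperplane {n : ℕ} {a : Eu n} (ha : a ≠ 0) :
    sphMeas n {w | inner ℝ (w : Eu n) a = 0} = 0 := by
  have hm : MeasurableSet {w : Sph n | inner ℝ (w : Eu n) a = 0} :=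
    (isClosed_eq (by fun_prop) continuous_const).measurableSet
  rw [sphMeas, Measure.toSphere_apply' _ hm]
  have hsub : (Ioo (0 : ℝ) 1 • (((↑) : Sph n → Eu n) '' {w : Sph n | inner ℝ (w : Eu n) a = 0})) ⊆
      (((ℝ ∙ a)ᗮ : Submodule ℝ (Eu n)) : Set (Eu n)) := by
    rintro _ ⟨r, -, _, ⟨w, hw, rfl⟩, rfl⟩
    rw [SetLike.mem_coe, Submodule.mem_orthogonal_singleton_iff_inner_left]
    change inner ℝ (r • (w : Eu n)) a = 0
    rw [real_inner_smul_left, show inner ℝ (w : Eu n) a = 0 from hw, mul_zero]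
  have hne : ((ℝ ∙ a)ᗮ : Submodule ℝ (Eu n)) ≠ ⊤ := by
    intro h
    have : a ∈ ((ℝ ∙ a)ᗮ : Submodule ℝ (Eu n)) := by rw [h]; trivial
    rw [Submodule.mem_orthogonal_singleton_iff_inner_left] at this
    exact ha (inner_self_eq_zero.1 this)
  rw [measure_mono_null hsub (Measure.addHaar_submodule _ _ hne), mul_zero]

section Polytope

variable {n m : ℕ} [Nonempty (Fin m)] {u : Fin m → Sph n} {z : Fin m → ℝ}

theorem mem_facetCone {i : Fin m} {w : Sph n} : w ∈ facetCone u z i ↔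
    (z i)⁻¹ * inner ℝ (w : Eu n) (u i : Eu n) = facetGauge u z⁻¹ w := Iff.rfl

theorem exists_mem_facetCone (u : Fin m → Sph n) (z : Fin m → ℝ) (w : Sph n) :
    ∃ i, w ∈ facetCone u z i :=
  exists_eq_facetGauge z⁻¹ w

theorem isClosed_facetCone (i : Fin m) : IsClosed (facetCone u z i) :=
  isClosed_eq (by fun_prop)
    ((continuous_facetGauge (u := u)).comp (Continuous.prodMk_right z⁻¹))

theorem smul_mem_polyOf_iff (hz : ∀ i, 0 < z i) {r : ℝ} (hr : 0 ≤ r) (w : Sph n) :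
    r • (w : Eu n) ∈ polyOf u z ↔ r * facetGauge u z⁻¹ w ≤ 1 := by
  rcases hr.eq_or_lt with rfl | hr
  · simpa [polyOf] using fun i => (hz i).le
  rw [← le_div_iff₀' hr, facetGauge_le_iff, polyOf]
  refine forall_congr' fun i => ?_
  rw [real_inner_smul_left, le_div_iff₀' hr, Pi.inv_apply,
    show r * ((z i)⁻¹ * inner ℝ (w : Eu n) (u i : Eu n))
      = r * inner ℝ (w : Eu n) (u i : Eu n) / z i by ring, div_le_one (hz i)]

variable (hu : ∀ v : Sph n, ∃ i, 0 < inner ℝ (v : Eu n) (u i : Eu n)) (hz : ∀ i, 0 < z i)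
include hu hz

theorem facetGauge_inv_pos (w : Sph n) : 0 < facetGauge u z⁻¹ w :=
  facetGauge_pos hu (fun i => inv_pos.2 (hz i)) w

theorem radialFn_polyOf (w : Sph n) : radialFn (polyOf u z) w = (facetGauge u z⁻¹ w)⁻¹ := by
  have hN := facetGauge_inv_pos hu hz w
  refine IsGreatest.csSup_eq ⟨⟨(inv_pos.2 hN).le, ?_⟩, ?_⟩
  · rw [smul_mem_polyOf_iff hz (inv_pos.2 hN).le, inv_mul_cancel₀ hN.ne']
  · rintro r ⟨hr, hr'⟩
    rw [smul_mem_polyOf_iff hz hr] at hr'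
    rwa [← one_div, le_div_iff₀ hN]

theorem radialMap_mem_polyOf (w : Sph n) : radialMap (polyOf u z) w ∈ polyOf u z := by
  have hN := facetGauge_inv_pos hu hz w
  rw [radialMap, radialFn_polyOf hu hz, smul_mem_polyOf_iff hz (inv_pos.2 hN).le,
    inv_mul_cancel₀ hN.ne']

theorem inner_radialMap_eq_iff {w : Sph n} {i : Fin m} :
    inner ℝ (radialMap (polyOf u z) w) (u i : Eu n) = z i ↔ w ∈ facetCone u z i := by
  have hN := facetGauge_inv_pos hu hz w
  rw [radialMap, radialFn_polyOf hu hz, real_inner_smul_left, mem_facetCone,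
    inv_mul_eq_iff_eq_mul₀ hN.ne', inv_mul_eq_iff_eq_mul₀ (hz i).ne', mul_comm (z i)]

theorem mem_normalCone_of_mem_facetCone {w : Sph n} {i : Fin m} (hi : w ∈ facetCone u z i) :
    (u i : Eu n) ∈ normalCone (polyOf u z) (radialMap (polyOf u z) w) := by
  intro x hx
  have h1 := (inner_radialMap_eq_iff hu hz).2 hi
  have h2 := hx i
  rw [inner_sub_right, real_inner_comm, real_inner_comm (radialMap (polyOf u z) w), h1]
  linarith

/-- If all facets through a boundary point have the same normal `u_i`, then `u_i` is the only
outer unit normal there: for another one `v`, a small step in the direction `v - u_i` would stay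
in the polytope and increase `⟨v, ·⟩`. -/
theorem eq_of_mem_normalCone {w v : Sph n} {i : Fin m}
    (huniq : ∀ j, w ∈ facetCone u z j → u j = u i)
    (hv : (v : Eu n) ∈ normalCone (polyOf u z) (radialMap (polyOf u z) w)) : v = u i := by
  by_contra hne
  have hlt : inner ℝ (v : Eu n) (u i : Eu n) < 1 := by
    refine (inner_lt_one_iff_real_of_norm_eq_one (by simp) (by simp)).2 fun h => hne (Subtype.ext h)
  set x := radialMap (polyOf u z) w
  have hstep : ∀ᶠ ε in 𝓝[>] (0 : ℝ), x + ε • ((v : Eu n) - u i) ∈ polyOf u z := by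
    refine eventually_all.2 fun j => ?_
    by_cases hj : w ∈ facetCone u z j
    · filter_upwards [self_mem_nhdsWithin] with ε hε
      rw [inner_add_left, (inner_radialMap_eq_iff hu hz).2 hj, huniq j hj, real_inner_smul_left,
        inner_sub_left, real_inner_self_eq_norm_sq]
      have : ε * (inner ℝ (v : Eu n) (u i : Eu n) - 1) ≤ 0 :=
        mul_nonpos_of_nonneg_of_nonpos (le_of_lt hε) (by linarith)
      simpa using this
    · have h1 : inner ℝ x (u j : Eu n) < z j := lt_of_le_of_ne
        (radialMap_mem_polyOf hu hz w j) fun h => hj ((inner_radialMap_eq_iff hu hz).1 h)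
      have h2 : ContinuousAt
          (fun ε : ℝ => inner ℝ (x + ε • ((v : Eu n) - u i)) (u j : Eu n)) 0 := by
        fun_prop
      have h3 := h2.eventually_lt_const (u := z j) (by simpa using h1)
      exact (h3.filter_mono nhdsWithin_le_nhds).mono fun ε h => h.le
  obtain ⟨ε, hε, hε0⟩ := (hstep.and self_mem_nhdsWithin).exists
  have h := hv _ hε
  rw [add_sub_cancel_left, real_inner_smul_right, inner_sub_right, real_inner_self_eq_norm_sq] at h
  have h4 : 0 < ε * (1 - inner ℝ (v : Eu n) (u i : Eu n)) := mul_pos hε0 (by linarith)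
  simp only [norm_eq_of_mem_sphere, one_pow] at h
  linarith

theorem radialGaussMap_polyOf {w : Sph n} {i : Fin m} (hi : w ∈ facetCone u z i)
    (huniq : ∀ j, w ∈ facetCone u z j → u j = u i) : radialGaussMap (polyOf u z) w = u i := by
  have h : ∃ v : Sph n, (v : Eu n) ∈ normalCone (polyOf u z) (radialMap (polyOf u z) w) :=
    ⟨u i, mem_normalCone_of_mem_facetCone hu hz hi⟩
  rw [radialGaussMap, dif_pos h]
  exact eq_of_mem_normalCone hu hz huniq h.choose_spec

theorem supportFn_polyOf_of_mem_facetCone {w : Sph n} {i : Fin m} (hi : w ∈ facetCone u z i) :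
    supportFn (polyOf u z) (u i) = z i := by
  refine IsGreatest.csSup_eq ⟨⟨_, radialMap_mem_polyOf hu hz w, ?_⟩, ?_⟩
  · simpa only [real_inner_comm] using (inner_radialMap_eq_iff hu hz).2 hi
  · rintro _ ⟨x, hx, rfl⟩
    simpa only [real_inner_comm] using hx i

theorem radialMap_mem_frontier (w : Sph n) :
    radialMap (polyOf u z) w ∈ frontier (polyOf u z) := by
  refine ⟨subset_closure (radialMap_mem_polyOf hu hz w), fun hint => ?_⟩
  obtain ⟨i, hi⟩ := exists_mem_facetCone u z w
  have hc : ContinuousAt (fun ε : ℝ => radialMap (polyOf u z) w + ε • (u i : Eu n)) 0 := by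
    fun_prop
  have hev : ∀ᶠ ε in 𝓝 (0 : ℝ), radialMap (polyOf u z) w + ε • (u i : Eu n) ∈ polyOf u z :=
    hc.eventually (by simpa using mem_interior_iff_mem_nhds.1 hint)
  obtain ⟨ε, hε, hε0⟩ := ((hev.filter_mono nhdsWithin_le_nhds).and
    (self_mem_nhdsWithin (s := Ioi (0 : ℝ)))).exists
  have h := hε i
  rw [inner_add_left, (inner_radialMap_eq_iff hu hz).2 hi, real_inner_smul_left,
    real_inner_self_eq_norm_sq, norm_eq_of_mem_sphere] at h
  have : 0 < ε := hε0
  linarith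

omit hu in
/-- Distinct outer normals occur together only along a great subsphere. -/
theorem ae_facetCone_unique :
    ∀ᵐ w ∂sphMeas n, ∀ i j, w ∈ facetCone u z i → w ∈ facetCone u z j → u j = u i := by
  refine eventually_countable_forall.2 fun i => eventually_countable_forall.2 fun j => ?_
  by_cases hij : u j = u i
  · exact Eventually.of_forall fun _ _ _ => hij
  have ha : (z i)⁻¹ • (u i : Eu n) - (z j)⁻¹ • (u j : Eu n) ≠ 0 := by
    intro h
    rw [sub_eq_zero] at h
    have hn := congrArg norm h
    rw [norm_smul, norm_smul, norm_eq_of_mem_sphere, norm_eq_of_mem_sphere, mul_one, mul_one,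
      Real.norm_of_nonneg (inv_pos.2 (hz i)).le, Real.norm_of_nonneg (inv_pos.2 (hz j)).le] at hn
    rw [hn] at h
    exact hij (Subtype.ext (smul_right_injective _ (inv_pos.2 (hz j)).ne' h).symm)
  refine measure_mono_null (fun w hw => ?_) (sphMeas_hyperplane ha)
  simp only [mem_compl_iff, mem_ofPred_eq, Classical.not_imp] at hw
  obtain ⟨h1, h2, -⟩ := hw
  rw [mem_ofPred_eq, inner_sub_right, real_inner_smul_right, real_inner_smul_right,
    mem_facetCone.1 h1, mem_facetCone.1 h2, sub_self]

theorem revRadialSphericalImage_polyOf_ae_eq (E : Set (Sph n)) :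
    revRadialSphericalImage (polyOf u z) E =ᵐ[sphMeas n] ⋃ i, ⋃ (_ : u i ∈ E), facetCone u z i := by
  filter_upwards [ae_facetCone_unique hz] with w hw
  refine propext ⟨fun ⟨_, v, hvE, hv⟩ => ?_, fun h => ?_⟩
  · obtain ⟨i, hi⟩ := exists_mem_facetCone u z w
    have := eq_of_mem_normalCone hu hz (fun j hj => hw i j hi hj) hv
    exact mem_iUnion₂.2 ⟨i, this ▸ hvE, hi⟩
  · obtain ⟨i, hiE, hi⟩ := mem_iUnion₂.1 h
    exact ⟨radialMap_mem_frontier hu hz w, u i, hiE, mem_normalCone_of_mem_facetCone hu hz hi⟩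

theorem isBodyAroundOrigin_polyOf : IsBodyAroundOrigin (polyOf u z) := by
  have hpoly : polyOf u z = ⋂ i, {x : Eu n | inner ℝ x (u i : Eu n) ≤ z i} := by
    ext x; simp [polyOf]
  refine ⟨?_, ?_, ?_⟩
  · rw [hpoly]
    refine convex_iInter fun i => convex_halfSpace_le ⟨fun x y => ?_, fun c x => ?_⟩ _
    · exact inner_add_left x y _
    · exact real_inner_smul_left x _ c
  · have hclosed : IsClosed (polyOf u z) := by
      rw [hpoly]
      exact isClosed_iInter fun i => isClosed_le (by fun_prop) continuous_const
    refine Metric.isCompact_of_isClosed_isBounded hclosed ?_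
    have hcont : Continuous fun w : Sph n => facetGauge u z⁻¹ w :=
      (continuous_facetGauge (u := u)).comp (Continuous.prodMk_right z⁻¹)
    obtain ⟨c, hc, hcN⟩ := isCompact_univ.exists_forall_le' hcont.continuousOn (a := 0)
      fun w _ => facetGauge_inv_pos hu hz w
    refine (Metric.isBounded_closedBall (x := (0 : Eu n)) (r := c⁻¹)).subset fun x hx => ?_
    rw [mem_closedBall_zero_iff]
    rcases eq_or_ne x 0 with rfl | hx0
    · simpa using hc.le
    have hx1 : 0 < ‖x‖ := norm_pos_iff.2 hx0
    let w : Sph n := ⟨‖x‖⁻¹ • x, by simp [norm_smul, hx1.ne']⟩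
    have hxw : x = ‖x‖ • (w : Eu n) := by simp [w, smul_smul, hx1.ne']
    have h1 : ‖x‖ * facetGauge u z⁻¹ w ≤ 1 := by
      rw [← smul_mem_polyOf_iff hz hx1.le, ← hxw]; exact hx
    rw [← one_div, le_div_iff₀ hc]
    exact (mul_le_mul_of_nonneg_left (hcN w (mem_univ _)) hx1.le).trans h1
  · rw [mem_interior_iff_mem_nhds]
    refine Filter.mem_of_superset (x := ⋂ i, {x : Eu n | inner ℝ x (u i : Eu n) < z i}) ?_ ?_
    · refine iInter_mem.2 fun i => IsOpen.mem_nhds (isOpen_lt (by fun_prop) continuous_const) ?_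
      simpa using hz i
    · intro x hx i
      exact (mem_iInter.1 hx i).le

omit hu hz [Nonempty (Fin m)] in
/-- An extreme point of a polyhedron is determined by the set of its active constraints, so there
are only finitely many. -/
theorem finite_extremePoints_polyOf : ((polyOf u z).extremePoints ℝ).Finite := by
  classical
  refine Set.Finite.of_injOn (f := fun x : Eu n => Finset.univ.filter
    fun i => inner ℝ x (u i : Eu n) = z i) (t := univ) (mapsTo_univ _ _) ?_ finite_univ
  intro x hx y hy hxy
  have hact : ∀ i, inner ℝ x (u i : Eu n) = z i → inner ℝ y (u i : Eu n) = z i := fun i hi => by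
    have : i ∈ Finset.univ.filter fun i => inner ℝ x (u i : Eu n) = z i := by simpa using hi
    rw [show (Finset.univ.filter fun i => inner ℝ x (u i : Eu n) = z i) = _ from hxy] at this
    simpa using this
  -- The segment from `y` to `x` can be prolonged a little beyond `x` within the polyhedron.
  have hstep : ∀ᶠ ε in 𝓝[>] (0 : ℝ), x + ε • (x - y) ∈ polyOf u z := by
    refine eventually_all.2 fun j => ?_
    by_cases hj : inner ℝ x (u j : Eu n) = z j
    · refine Eventually.of_forall fun ε => ?_
      rw [inner_add_left, real_inner_smul_left, inner_sub_left, hact j hj, hj]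
      simp
    · have h1 : inner ℝ x (u j : Eu n) < z j := lt_of_le_of_ne (hx.1 j) hj
      have h2 : ContinuousAt (fun ε : ℝ => inner ℝ (x + ε • (x - y)) (u j : Eu n)) 0 := by
        fun_prop
      have h3 := h2.eventually_lt_const (u := z j) (by simpa using h1)
      exact (h3.filter_mono nhdsWithin_le_nhds).mono fun ε h => h.le
  obtain ⟨ε, hε, hε0⟩ := (hstep.and (self_mem_nhdsWithin (s := Ioi (0 : ℝ)))).exists
  have hε0 : 0 < ε := hε0
  refine (hx.2 hy.1 hε ?_).symm
  refine ⟨ε / (1 + ε), 1 / (1 + ε), by positivity, by positivity, by field_simp; ring, ?_⟩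
  rw [smul_add, smul_smul, smul_sub]
  have h1 : (1 / (1 + ε)) * ε = ε / (1 + ε) := by ring
  have h2 : (1 / (1 + ε)) • x + (ε / (1 + ε)) • x = x := by
    rw [← add_smul, ← add_div, div_self (by positivity), one_smul]
  rw [h1]
  nth_rewrite 3 [← h2]
  abel

theorem isConvexPolytope_polyOf : IsConvexPolytope (polyOf u z) := by
  have hbody := isBodyAroundOrigin_polyOf hu hz
  refine ⟨(polyOf u z).extremePoints ℝ, finite_extremePoints_polyOf, ?_⟩
  rw [← ((finite_extremePoints_polyOf (u := u) (z := z)).isClosed_convexHull ℝ).closure_eq,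
    closure_convexHull_extremePoints hbody.2.1 hbody.1]

end Polytope

/-! ### Continuity and first variation of the dual volume -/

section Variation

variable {n m : ℕ} [Nonempty (Fin m)] {u : Fin m → Sph n} {G : ℝ → Sph n → ℝ}

theorem continuousOn_comp_facetGauge
    (hu : ∀ v : Sph n, ∃ i, 0 < inner ℝ (v : Eu n) (u i : Eu n))
    (hGcont : ContinuousOn (fun p : ℝ × Sph n => G p.1 p.2) (Ioi 0 ×ˢ univ)) :
    ContinuousOn (fun p : (Fin m → ℝ) × Sph n => G (facetGauge u p.1 p.2)⁻¹ p.2)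
      ({y | ∀ i, 0 < y i} ×ˢ univ) := by
  have h : ContinuousOn (fun p : (Fin m → ℝ) × Sph n => ((facetGauge u p.1 p.2)⁻¹, p.2))
      ({y | ∀ i, 0 < y i} ×ˢ univ) :=
    ((continuous_facetGauge (u := u)).continuousOn.inv₀
      fun p hp => (facetGauge_pos hu hp.1 p.2).ne').prodMk continuous_snd.continuousOn
  exact hGcont.comp h fun p hp => ⟨inv_pos.2 (facetGauge_pos hu hp.1 p.2), mem_univ _⟩

theorem continuous_comp_facetGauge
    (hu : ∀ v : Sph n, ∃ i, 0 < inner ℝ (v : Eu n) (u i : Eu n))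
    (hGcont : ContinuousOn (fun p : ℝ × Sph n => G p.1 p.2) (Ioi 0 ×ˢ univ))
    {y : Fin m → ℝ} (hy : ∀ i, 0 < y i) :
    Continuous fun w => G (facetGauge u y w)⁻¹ w :=
  (continuousOn_comp_facetGauge hu hGcont).comp_continuous (Continuous.prodMk_right y)
    fun _ => ⟨hy, mem_univ _⟩

theorem dualVolume_polyOf (hu : ∀ v : Sph n, ∃ i, 0 < inner ℝ (v : Eu n) (u i : Eu n))
    {z : Fin m → ℝ} (hz : ∀ i, 0 < z i) :
    dualVolume G (polyOf u z) = ∫ w, G (facetGauge u z⁻¹ w)⁻¹ w ∂sphMeas n := by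
  simp only [dualVolume, radialFn_polyOf hu hz]

theorem continuousOn_comp_facetGauge_inv
    (hu : ∀ v : Sph n, ∃ i, 0 < inner ℝ (v : Eu n) (u i : Eu n))
    (hGcont : ContinuousOn (fun p : ℝ × Sph n => G p.1 p.2) (Ioi 0 ×ˢ univ)) :
    ContinuousOn (fun p : (Fin m → ℝ) × Sph n => G (facetGauge u p.1⁻¹ p.2)⁻¹ p.2)
      ({z | ∀ i, 0 < z i} ×ˢ univ) := by
  have hinv : ContinuousOn (fun p : (Fin m → ℝ) × Sph n => (p.1⁻¹, p.2))
      ({z | ∀ i, 0 < z i} ×ˢ univ) := by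
    refine ContinuousOn.prodMk (continuousOn_pi.2 fun i => ?_) continuous_snd.continuousOn
    exact ContinuousOn.inv₀ (by fun_prop) fun p hp => (hp.1 i).ne'
  have hmaps : MapsTo (fun p : (Fin m → ℝ) × Sph n => (p.1⁻¹, p.2))
      ({z | ∀ i, 0 < z i} ×ˢ univ) ({y | ∀ i, 0 < y i} ×ˢ univ) :=
    fun p hp => ⟨fun i => inv_pos.2 (hp.1 i), mem_univ _⟩
  have h := (continuousOn_comp_facetGauge hu hGcont).comp' hinv hmaps
  exact h

theorem continuousOn_dualVolume_polyOf
    (hu : ∀ v : Sph n, ∃ i, 0 < inner ℝ (v : Eu n) (u i : Eu n))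
    (hGcont : ContinuousOn (fun p : ℝ × Sph n => G p.1 p.2) (Ioi 0 ×ˢ univ))
    {δ : ℝ} (hδ : 0 < δ) (M : ℝ) :
    ContinuousOn (fun z => dualVolume G (polyOf u z))
      (Icc (fun _ : Fin m => δ) (fun _ => M)) := by
  have hpos : ∀ z ∈ Icc (fun _ : Fin m => δ) (fun _ => M), ∀ i, 0 < z i :=
    fun z hz i => hδ.trans_le (hz.1 i)
  refine ContinuousOn.congr (f := fun z => ∫ w, G (facetGauge u z⁻¹ w)⁻¹ w ∂sphMeas n) ?_
    fun z hz => dualVolume_polyOf hu (hpos z hz)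
  have hjoint : ContinuousOn
      (fun p : (Fin m → ℝ) × Sph n => G (facetGauge u p.1⁻¹ p.2)⁻¹ p.2)
      (Icc (fun _ : Fin m => δ) (fun _ => M) ×ˢ univ) :=
    (continuousOn_comp_facetGauge_inv hu hGcont).mono (prod_mono_left hpos)
  obtain ⟨C, hC⟩ := (isCompact_Icc.prod isCompact_univ).exists_bound_of_continuousOn hjoint
  refine continuousOn_of_dominated (bound := fun _ => C) (fun z hz => ?_) (fun z hz => ?_)
    (integrable_const C) (Eventually.of_forall fun w => ?_)
  · exact (continuous_comp_facetGauge hu hGcont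
      fun i => inv_pos.2 (hpos z hz i)).aestronglyMeasurable
  · exact Eventually.of_forall fun w => hC (z, w) ⟨hz, mem_univ _⟩
  · exact hjoint.comp (f := fun z : Fin m → ℝ => (z, w)) (by fun_prop)
      fun z hz => ⟨hz, mem_univ _⟩

theorem hasDerivAt_comp_inv (hGdiff : ∀ t, 0 < t → ∀ v, DifferentiableAt ℝ (fun s => G s v) t)
    {g : ℝ → ℝ} {g' s : ℝ} (hg : HasDerivAt g g' s) (hs : 0 < g s) (w : Sph n) :
    HasDerivAt (fun t => G (g t)⁻¹ w) (partialT G (g s)⁻¹ w * (-g' / g s ^ 2)) s :=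
  HasDerivAt.comp (h₂ := fun t => G t w) s (hGdiff _ (inv_pos.2 hs) w).hasDerivAt
    (hg.fun_inv hs.ne')

theorem exists_lipschitz_comp_inv
    (hGdiff : ∀ t, 0 < t → ∀ v, DifferentiableAt ℝ (fun s => G s v) t)
    (hGtcont : ContinuousOn (fun p : ℝ × Sph n => partialT G p.1 p.2) (Ioi 0 ×ˢ univ))
    {a : ℝ} (ha : 0 < a) (b : ℝ) :
    ∃ C, 0 ≤ C ∧ ∀ w, ∀ p ∈ Icc a b, ∀ q ∈ Icc a b, |G p⁻¹ w - G q⁻¹ w| ≤ C * |p - q| := by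
  have hcont : ContinuousOn (fun p : ℝ × Sph n => partialT G p.1⁻¹ p.2 * (-1 / p.1 ^ 2))
      (Icc a b ×ˢ univ) := by
    have hne : ∀ p ∈ Icc a b ×ˢ (univ : Set (Sph n)), p.1 ≠ 0 := fun p hp =>
      (ha.trans_le hp.1.1).ne'
    refine ContinuousOn.mul ?_
      (continuousOn_const.div (by fun_prop) fun p hp => pow_ne_zero 2 (hne p hp))
    have h : ContinuousOn (fun p : ℝ × Sph n => (p.1⁻¹, p.2)) (Icc a b ×ˢ univ) :=
      (continuous_fst.continuousOn.inv₀ hne).prodMk continuous_snd.continuousOn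
    exact hGtcont.comp h fun p hp => ⟨inv_pos.2 (ha.trans_le hp.1.1), mem_univ _⟩
  obtain ⟨C, hC⟩ := (isCompact_Icc.prod isCompact_univ).exists_bound_of_continuousOn hcont
  refine ⟨max C 0, le_max_right _ _, fun w p hp q hq => ?_⟩
  have := (convex_Icc a b).norm_image_sub_le_of_norm_hasDerivWithin_le
    (f := fun t => G t⁻¹ w) (f' := fun t => partialT G t⁻¹ w * (-1 / t ^ 2)) (C := max C 0)
    (fun t ht => (hasDerivAt_comp_inv hGdiff (hasDerivAt_id t)
      (ha.trans_le ht.1) w).hasDerivWithinAt)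
    (fun t ht => (hC (t, w) ⟨ht, mem_univ _⟩).trans (le_max_left _ _)) hq hp
  simpa only [Real.norm_eq_abs] using this

/-- First variation of the dual volume along a curve of facet distances `ζ_i` with `ζ_i(0) = z_i`
and `ζ_i'(0) = d_i`. The common value of `d_i / z_i` over the facets met in direction `w` is the
logarithmic derivative of the radial function in that direction. -/
theorem hasDerivAt_dualVolume_polyOf
    (hu : ∀ v : Sph n, ∃ i, 0 < inner ℝ (v : Eu n) (u i : Eu n))
    (hGcont : ContinuousOn (fun p : ℝ × Sph n => G p.1 p.2) (Ioi 0 ×ˢ univ))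
    (hGdiff : ∀ t, 0 < t → ∀ v, DifferentiableAt ℝ (fun s => G s v) t)
    (hGtcont : ContinuousOn (fun p : ℝ × Sph n => partialT G p.1 p.2) (Ioi 0 ×ˢ univ))
    {ζ : ℝ → Fin m → ℝ} {z d : Fin m → ℝ} (hζ0 : ζ 0 = z) (hz : ∀ i, 0 < z i)
    (hζ : ∀ i, HasStrictDerivAt (fun s => ζ s i) (d i) 0) {k : Sph n → ℝ}
    (hk : ∀ᵐ w ∂sphMeas n, ∀ i, w ∈ facetCone u z i → d i / z i = k w) :
    Integrable (fun w => radialFn (polyOf u z) w * partialT G (radialFn (polyOf u z) w) w * k w)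
        (sphMeas n) ∧
      HasDerivAt (fun s => dualVolume G (polyOf u (ζ s)))
        (∫ w, radialFn (polyOf u z) w * partialT G (radialFn (polyOf u z) w) w * k w ∂sphMeas n)
        0 := by
  subst hζ0
  have hζcont : ∀ i, ContinuousAt (fun s => ζ s i) 0 := fun i => (hζ i).hasDerivAt.continuousAt
  have hζpos : ∀ᶠ s in 𝓝 0, ∀ i, 0 < ζ s i :=
    eventually_all.2 fun i => (hζcont i).eventually_const_lt (hz i)
  have hy : ∀ i, HasStrictDerivAt (fun s => (ζ s)⁻¹ i) (-d i / ζ 0 i ^ 2) 0 := fun i => by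
    have h := (hasStrictDerivAt_inv (hz i).ne').comp (0 : ℝ) (hζ i)
    rwa [neg_mul, inv_mul_eq_div, ← neg_div] at h
  -- A box of positive facet parameters around the base point.
  obtain ⟨δ, M, hδ, hbox⟩ : ∃ δ M : ℝ, 0 < δ ∧ ∀ᶠ s in 𝓝 0,
      (ζ s)⁻¹ ∈ Icc (fun _ : Fin m => δ) (fun _ => M) := by
    have hypos : ∀ i, 0 < (ζ 0)⁻¹ i := fun i => inv_pos.2 (hz i)
    obtain ⟨δ, hδ, hδ'⟩ : ∃ δ, 0 < δ ∧ ∀ i ∈ (univ : Set (Fin m)), δ ≤ (ζ 0)⁻¹ i :=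
      finite_univ.isCompact.exists_forall_le' (continuous_of_discreteTopology.continuousOn)
        fun i _ => hypos i
    obtain ⟨M, hM⟩ := (finite_range (ζ 0)⁻¹).bddAbove
    refine ⟨δ / 2, M + 1, half_pos hδ, ?_⟩
    have h1 : ∀ᶠ s in 𝓝 0, ∀ i, δ / 2 < (ζ s)⁻¹ i := eventually_all.2 fun i =>
      (hy i).hasDerivAt.continuousAt.eventually_const_lt
        ((half_lt_self hδ).trans_le (hδ' i (mem_univ i)))
    have h2 : ∀ᶠ s in 𝓝 0, ∀ i, (ζ s)⁻¹ i < M + 1 := eventually_all.2 fun i =>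
      (hy i).hasDerivAt.continuousAt.eventually_lt_const
        ((hM ⟨i, rfl⟩ : (ζ 0)⁻¹ i ≤ M).trans_lt (lt_add_one M))
    filter_upwards [h1, h2] with s hs1 hs2
    exact ⟨fun i => (hs1 i).le, fun i => (hs2 i).le⟩
  obtain ⟨a, b, ha, hab⟩ := exists_facetGauge_bounds hu hδ M
  obtain ⟨C, hC0, hC⟩ := exists_lipschitz_comp_inv hGdiff hGtcont ha b
  obtain ⟨L, t, ht, hL⟩ := (hasStrictDerivAt_pi.2 hy).hasStrictFDerivAt.exists_lipschitzOnWith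
  set F : ℝ → Sph n → ℝ := fun s w => G (facetGauge u (ζ s)⁻¹ w)⁻¹ w with hF
  have hFcont : ∀ s, (∀ i, 0 < ζ s i) → Continuous (F s) := fun s hs =>
    continuous_comp_facetGauge hu hGcont fun i => inv_pos.2 (hs i)
  have hFlip : ∀ w, LipschitzOnWith (Real.nnabs (C * L)) (F · w)
      (t ∩ {s | (ζ s)⁻¹ ∈ Icc (fun _ : Fin m => δ) (fun _ => M)}) := by
    intro w
    refine LipschitzOnWith.of_dist_le_mul fun s hs s' hs' => ?_
    rw [Real.dist_eq, Real.coe_nnabs, abs_of_nonneg (mul_nonneg hC0 L.coe_nonneg)]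
    calc |F s w - F s' w|
        ≤ C * |facetGauge u (ζ s)⁻¹ w - facetGauge u (ζ s')⁻¹ w| :=
          hC w _ (hab _ hs.2 w) _ (hab _ hs'.2 w)
      _ ≤ C * dist (ζ s)⁻¹ (ζ s')⁻¹ := by gcongr; exact abs_facetGauge_sub_le _ _ w
      _ ≤ C * (L * dist s s') := by gcongr; exact hL.dist_le_mul s hs.1 s' hs'.1
      _ = C * L * dist s s' := by ring
  have hFder : ∀ᵐ w ∂sphMeas n, HasDerivAt (F · w) (radialFn (polyOf u (ζ 0)) w *
      partialT G (radialFn (polyOf u (ζ 0)) w) w * k w) 0 := by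
    filter_upwards [hk] with w hw
    have hN := facetGauge_inv_pos hu hz w
    have hmax : HasDerivAt (fun s => facetGauge u (ζ s)⁻¹ w)
        (-(k w * facetGauge u (ζ 0)⁻¹ w)) 0 := by
      refine hasDerivAt_finset_sup' (f := fun i s => (ζ s)⁻¹ i * inner ℝ (w : Eu n) (u i : Eu n))
        _ (fun i _ => (hy i).hasDerivAt.continuousAt.mul continuousAt_const) fun i _ hi => ?_
      have hi' : w ∈ facetCone u (ζ 0) i := hi
      have hD : -(k w * facetGauge u (ζ 0)⁻¹ w)
          = -d i / ζ 0 i ^ 2 * inner ℝ (w : Eu n) (u i : Eu n) := by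
        rw [← hw i hi', ← mem_facetCone.1 hi']
        have := (hz i).ne'
        field_simp
      rw [hD]
      exact (hy i).hasDerivAt.mul_const (inner ℝ (w : Eu n) (u i : Eu n))
    rw [radialFn_polyOf hu hz]
    have h := hasDerivAt_comp_inv hGdiff hmax hN w
    have hD : partialT G (facetGauge u (ζ 0)⁻¹ w)⁻¹ w *
        (-(-(k w * facetGauge u (ζ 0)⁻¹ w)) / facetGauge u (ζ 0)⁻¹ w ^ 2)
        = (facetGauge u (ζ 0)⁻¹ w)⁻¹ * partialT G (facetGauge u (ζ 0)⁻¹ w)⁻¹ w * k w := by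
      field_simp
    rwa [hD] at h
  have hF'meas : AEStronglyMeasurable (fun w => radialFn (polyOf u (ζ 0)) w *
      partialT G (radialFn (polyOf u (ζ 0)) w) w * k w) (sphMeas n) := by
    classical
    -- The derivative is an a.e. limit of difference quotients. These are continuous in `w` as long
    -- as the facet distances are positive, and are replaced by `0` for the other `s`.
    refine aestronglyMeasurable_of_tendsto_ae (𝓝[≠] (0 : ℝ))
      (f := fun s w => if ∀ i, 0 < ζ s i then slope (F · w) 0 s else 0) (fun s => ?_) ?_
    · by_cases hs : ∀ i, 0 < ζ s i
      · simp only [if_pos hs, slope_def_field]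
        exact (((hFcont s hs).sub (hFcont 0 hz)).div_const _).aestronglyMeasurable
      · simp only [if_neg hs]
        exact aestronglyMeasurable_const
    · filter_upwards [hFder] with w hw
      refine (hasDerivAt_iff_tendsto_slope.1 hw).congr' ?_
      filter_upwards [hζpos.filter_mono nhdsWithin_le_nhds] with s hs
      rw [if_pos hs]
  have hmain := hasDerivAt_integral_of_dominated_loc_of_lip (μ := sphMeas n) (F := F)
    (bound := fun _ => C * L) (inter_mem ht hbox)
    (hζpos.mono fun s hs => (hFcont s hs).aestronglyMeasurable)
    ((hFcont 0 hz).integrable_of_hasCompactSupport (HasCompactSupport.of_compactSpace _)) hF'meas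
    (Eventually.of_forall hFlip) (integrable_const _) hFder
  refine ⟨hmain.1, hmain.2.congr_of_eventuallyEq ?_⟩
  filter_upwards [hζpos] with s hs
  exact dualVolume_polyOf hu hs

end Variation

/-! ### Existence of a minimizer -/

theorem strictAntiOn_of_partialT_neg {n : ℕ} {G : ℝ → Sph n → ℝ}
    (hGdiff : ∀ t, 0 < t → ∀ v, DifferentiableAt ℝ (fun s => G s v) t)
    (hGtneg : ∀ t, 0 < t → ∀ v, partialT G t v < 0) (v : Sph n) :
    StrictAntiOn (fun t => G t v) (Ioi 0) := by
  refine strictAntiOn_of_deriv_neg (convex_Ioi 0)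
    (fun t ht => (hGdiff t ht v).continuousAt.continuousWithinAt) fun t ht => ?_
  rw [interior_Ioi] at ht
  exact hGtneg t ht v

/-- A facet at distance `t ε` from the origin keeps the radial function below `t` on the cap
around its normal, so the dual volume is at least the integral of `G t` over that cap. -/
theorem setIntegral_cap_le_dualVolume {n m : ℕ} [Nonempty (Fin m)] {u : Fin m → Sph n}
    {G : ℝ → Sph n → ℝ}
    (hu : ∀ v : Sph n, ∃ i, 0 < inner ℝ (v : Eu n) (u i : Eu n))
    (hGpos : ∀ t, 0 < t → ∀ v, 0 < G t v)
    (hGcont : ContinuousOn (fun p : ℝ × Sph n => G p.1 p.2) (Ioi 0 ×ˢ univ))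
    (hGdiff : ∀ t, 0 < t → ∀ v, DifferentiableAt ℝ (fun s => G s v) t)
    (hGtneg : ∀ t, 0 < t → ∀ v, partialT G t v < 0)
    {ε : ℝ} (hε : 0 < ε) {z : Fin m → ℝ} (hz : ∀ i, 0 < z i) (i : Fin m) :
    ∫ w in cap ε (u i), G (z i / ε) w ∂sphMeas n ≤ dualVolume G (polyOf u z) := by
  have ht : 0 < z i / ε := div_pos (hz i) hε
  have hcap : MeasurableSet (cap ε (u i)) :=
    (isClosed_le continuous_const (by fun_prop)).measurableSet
  have hint : ∀ {f : Sph n → ℝ}, Continuous f → Integrable f (sphMeas n) := fun hf =>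
    hf.integrable_of_hasCompactSupport (HasCompactSupport.of_compactSpace _)
  have h1 : Integrable (G (z i / ε)) (sphMeas n) :=
    hint (hGcont.comp_continuous (Continuous.prodMk_right (z i / ε)) fun w => ⟨ht, mem_univ _⟩)
  have h2 : Integrable (fun w => G (facetGauge u z⁻¹ w)⁻¹ w) (sphMeas n) :=
    hint (continuous_comp_facetGauge hu hGcont fun j => inv_pos.2 (hz j))
  rw [dualVolume_polyOf hu hz]
  refine (setIntegral_mono_on h1.integrableOn h2.integrableOn hcap fun w hw => ?_).trans
    (setIntegral_le_integral h2 (Eventually.of_forall fun w =>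
      (hGpos _ (inv_pos.2 (facetGauge_inv_pos hu hz w)) w).le))
  have hN := facetGauge_inv_pos hu hz w
  refine (strictAntiOn_of_partialT_neg hGdiff hGtneg w).antitoneOn (inv_pos.2 hN) ht ?_
  have h3 : (z i)⁻¹ * ε ≤ facetGauge u z⁻¹ w :=
    (mul_le_mul_of_nonneg_left hw (inv_pos.2 (hz i)).le).trans (le_facetGauge z⁻¹ w i)
  calc (facetGauge u z⁻¹ w)⁻¹ ≤ ((z i)⁻¹ * ε)⁻¹ :=
        inv_anti₀ (mul_pos (inv_pos.2 (hz i)) hε) h3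
    _ = z i / ε := by rw [mul_inv, inv_inv, div_eq_mul_inv]

theorem exists_dualVolume_minimizer {n m : ℕ} [Nonempty (Fin m)] {u : Fin m → Sph n}
    {G : ℝ → Sph n → ℝ} {lam : Fin m → ℝ} (hlam : ∀ i, 0 < lam i)
    (hu : ∀ v : Sph n, ∃ i, 0 < inner ℝ (v : Eu n) (u i : Eu n))
    (hGpos : ∀ t, 0 < t → ∀ v, 0 < G t v)
    (hGcont : ContinuousOn (fun p : ℝ × Sph n => G p.1 p.2) (Ioi 0 ×ˢ univ))
    (hGdiff : ∀ t, 0 < t → ∀ v, DifferentiableAt ℝ (fun s => G s v) t)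
    (hGtneg : ∀ t, 0 < t → ∀ v, partialT G t v < 0)
    {ε : ℝ} (hε : 0 < ε)
    (hblow : ∀ v : Sph n,
      Tendsto (fun t : ℝ => ∫ w in cap ε v, G t w ∂(sphMeas n)) (𝓝[>] 0) atTop)
    {ψ : ℝ → ℝ} (hψpos : ∀ t, 0 < t → 0 < ψ t) (hψcont : ContinuousOn ψ (Ioi 0))
    (hψinf : ∫⁻ s in Ioi (1 : ℝ), ENNReal.ofReal (ψ s / s) = ⊤)
    (hφfin : ∀ t, 0 < t → ∫⁻ s in Ioc (0 : ℝ) t, ENNReal.ofReal (ψ s / s) < ⊤) :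
    ∃ z ∈ constraintSet (phi ψ) lam, ∀ z' ∈ constraintSet (phi ψ) lam,
      dualVolume G (polyOf u z) ≤ dualVolume G (polyOf u z') := by
  have hone : (fun _ => 1 : Fin m → ℝ) ∈ constraintSet (phi ψ) lam := ⟨fun _ => one_pos, rfl⟩
  set V₀ := dualVolume G (polyOf u fun _ => 1)
  obtain ⟨M, hM0, hM⟩ := exists_constraintSet_le hlam hψpos hψcont hψinf hφfin
  -- Facets too close to the origin make the dual volume exceed its value at `z = 1`.
  have hlow : ∀ i, ∃ δ, 0 < δ ∧ ∀ z ∈ constraintSet (phi ψ) lam,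
      dualVolume G (polyOf u z) ≤ V₀ → δ ≤ z i := by
    intro i
    obtain ⟨η, hη, hη'⟩ := mem_nhdsGT_iff_exists_Ioo_subset.1
      ((hblow (u i)).eventually_gt_atTop V₀)
    refine ⟨η * ε, mul_pos hη hε, fun z hz hV => ?_⟩
    by_contra! h
    have h1 : V₀ < ∫ w in cap ε (u i), G (z i / ε) w ∂(sphMeas n) :=
      hη' ⟨div_pos (hz.1 i) hε, (div_lt_iff₀ hε).2 h⟩
    have h2 := setIntegral_cap_le_dualVolume hu hGpos hGcont hGdiff hGtneg hε hz.1 i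
    linarith
  choose δ' hδ' hδ using hlow
  obtain ⟨δ, hδ0, hδle⟩ : ∃ δ, 0 < δ ∧ ∀ i ∈ (univ : Set (Fin m)), δ ≤ δ' i :=
    finite_univ.isCompact.exists_forall_le' continuous_of_discreteTopology.continuousOn
      fun i _ => hδ' i
  have hbox : ∀ z ∈ constraintSet (phi ψ) lam, dualVolume G (polyOf u z) ≤ V₀ →
      z ∈ Icc (fun _ : Fin m => δ) (fun _ => M) := fun z hz hV =>
    ⟨fun i => (hδle i (mem_univ i)).trans (hδ i z hz hV), hM z hz⟩
  have hpos : ∀ z ∈ Icc (fun _ : Fin m => δ) (fun _ => M), ∀ i, 0 < z i :=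
    fun z hz i => hδ0.trans_le (hz.1 i)
  have hsum : ContinuousOn (fun z : Fin m → ℝ => ∑ i, lam i * phi ψ (z i))
      (Icc (fun _ => δ) (fun _ => M)) := by
    refine continuousOn_finsetSum _ fun i _ => continuousOn_const.mul ?_
    exact (continuousOn_phi hψpos hψcont hφfin).comp (continuous_apply i).continuousOn
      fun z hz => hpos z hz i
  have hK : IsCompact (Icc (fun _ => δ) (fun _ => M) ∩
      (fun z : Fin m → ℝ => ∑ i, lam i * phi ψ (z i)) ⁻¹' {∑ i, lam i * phi ψ 1}) :=
    isCompact_Icc.of_isClosed_subset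
      (hsum.preimage_isClosed_of_isClosed isClosed_Icc isClosed_singleton) inter_subset_left
  obtain ⟨z, hzK, hmin⟩ := hK.exists_isMinOn ⟨_, hbox _ hone le_rfl, rfl⟩
    ((continuousOn_dualVolume_polyOf hu hGcont hδ0 M).mono inter_subset_left)
  refine ⟨z, ⟨hpos z hzK.1, hzK.2⟩, fun z' hz' => ?_⟩
  rcases le_total (dualVolume G (polyOf u z')) V₀ with h | h
  · exact hmin ⟨hbox z' hz' h, hz'.2⟩
  · exact (hmin ⟨hbox _ hone le_rfl, rfl⟩).trans h

/-! ### The Euler–Lagrange equation of a minimizer -/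

/-- The integrand of `curvMeas`, the density of the curvature measure in radial coordinates. -/
noncomputable def curvDensity {n : ℕ} (G : ℝ → Sph n → ℝ) (ψ : ℝ → ℝ) (K : Set (Eu n))
    (w : Sph n) : ℝ :=
  radialFn K w * partialT G (radialFn K w) w / ψ (supportFn K (radialGaussMap K w))

section EulerLagrange

variable {n m : ℕ} [Nonempty (Fin m)] {u : Fin m → Sph n} {z : Fin m → ℝ}
  {G : ℝ → Sph n → ℝ} {ψ : ℝ → ℝ}

theorem ae_radialGaussMap_polyOf
    (hu : ∀ v : Sph n, ∃ i, 0 < inner ℝ (v : Eu n) (u i : Eu n)) (hz : ∀ i, 0 < z i) :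
    ∀ᵐ w ∂sphMeas n, ∀ i, w ∈ facetCone u z i →
      radialGaussMap (polyOf u z) w = u i ∧
        supportFn (polyOf u z) (radialGaussMap (polyOf u z) w) = z i := by
  filter_upwards [ae_facetCone_unique (u := u) hz] with w hw i hi
  have h := radialGaussMap_polyOf hu hz hi fun j hj => hw i j hi hj
  exact ⟨h, by rw [h, supportFn_polyOf_of_mem_facetCone hu hz hi]⟩

theorem ae_psi_supportFn_pos
    (hu : ∀ v : Sph n, ∃ i, 0 < inner ℝ (v : Eu n) (u i : Eu n)) (hz : ∀ i, 0 < z i)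
    (hψpos : ∀ t, 0 < t → 0 < ψ t) :
    ∀ᵐ w ∂sphMeas n, 0 < ψ (supportFn (polyOf u z) (radialGaussMap (polyOf u z) w)) := by
  filter_upwards [ae_radialGaussMap_polyOf hu hz] with w hw
  obtain ⟨i, hi⟩ := exists_mem_facetCone u z w
  rw [(hw i hi).2]
  exact hψpos _ (hz i)

theorem radialFn_mul_partialT_neg
    (hu : ∀ v : Sph n, ∃ i, 0 < inner ℝ (v : Eu n) (u i : Eu n)) (hz : ∀ i, 0 < z i)
    (hGtneg : ∀ t, 0 < t → ∀ v, partialT G t v < 0) (w : Sph n) :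
    radialFn (polyOf u z) w * partialT G (radialFn (polyOf u z) w) w < 0 := by
  have h : 0 < radialFn (polyOf u z) w := by
    rw [radialFn_polyOf hu hz]; exact inv_pos.2 (facetGauge_inv_pos hu hz w)
  exact mul_neg_of_pos_of_neg h (hGtneg _ h w)

theorem integral_neg_of_ae_neg {α : Type*} [MeasurableSpace α] {ν : Measure α} (hν : ν ≠ 0)
    {f : α → ℝ} (hf : Integrable f ν) (hneg : ∀ᵐ x ∂ν, f x < 0) : ∫ x, f x ∂ν < 0 := by
  have h0 : 0 ≤ᵐ[ν] fun x => -f x := hneg.mono fun x hx => by simpa using hx.le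
  refine lt_of_le_of_ne (integral_nonpos_of_ae (hneg.mono fun x hx => hx.le)) fun h => ?_
  have h1 : (fun x => -f x) =ᵐ[ν] 0 := by
    rw [← integral_eq_zero_iff_of_nonneg_ae h0 hf.neg, integral_neg, h, neg_zero]
  have : NeZero ν := ⟨hν⟩
  obtain ⟨x, hx1, hx2⟩ := (h1.and hneg).exists
  simp only [Pi.zero_apply] at hx1
  linarith

theorem sphMeas_ne_zero (hn : 1 ≤ n) : sphMeas n ≠ 0 := by
  have : Nonempty (Fin n) := ⟨⟨0, hn⟩⟩
  have : Nontrivial (Eu n) := by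
    refine Module.nontrivial_of_finrank_pos (R := ℝ) ?_
    rw [finrank_euclideanSpace_fin]; exact hn
  exact Measure.toSphere_ne_zero _

theorem integrable_curvDensity
    (hu : ∀ v : Sph n, ∃ i, 0 < inner ℝ (v : Eu n) (u i : Eu n)) (hz : ∀ i, 0 < z i)
    (hGcont : ContinuousOn (fun p : ℝ × Sph n => G p.1 p.2) (Ioi 0 ×ˢ univ))
    (hGdiff : ∀ t, 0 < t → ∀ v, DifferentiableAt ℝ (fun s => G s v) t)
    (hGtcont : ContinuousOn (fun p : ℝ × Sph n => partialT G p.1 p.2) (Ioi 0 ×ˢ univ))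
    (f : Sph n → ℝ) :
    Integrable (fun w => f (radialGaussMap (polyOf u z) w) * curvDensity G ψ (polyOf u z) w)
      (sphMeas n) := by
  -- This is the integrand of the first variation along a line.
  have hζ : ∀ i, HasStrictDerivAt (fun s : ℝ => z i + s * (f (u i) / ψ (z i) * z i))
      (f (u i) / ψ (z i) * z i) 0 := fun i => by
    simpa using ((hasStrictDerivAt_id (0 : ℝ)).mul_const (f (u i) / ψ (z i) * z i)).const_add (z i)
  have h := (hasDerivAt_dualVolume_polyOf hu hGcont hGdiff hGtcont (z := z)
    (ζ := fun s i => z i + s * (f (u i) / ψ (z i) * z i)) (by simp) hz hζ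
    (k := fun w => f (radialGaussMap (polyOf u z) w) /
      ψ (supportFn (polyOf u z) (radialGaussMap (polyOf u z) w))) ?_).1
  · refine h.congr (Eventually.of_forall fun w => ?_)
    simp only [curvDensity]
    ring
  · filter_upwards [ae_radialGaussMap_polyOf hu hz] with w hw i hi
    rw [(hw i hi).2, (hw i hi).1, mul_div_cancel_right₀ _ (hz i).ne']

variable {lam : Fin m → ℝ}

/-- Stationarity of the dual volume at a minimizer along all curves that stay in the constraint
set. -/
theorem integral_eq_zero_of_minimizer
    (hu : ∀ v : Sph n, ∃ i, 0 < inner ℝ (v : Eu n) (u i : Eu n))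
    (hGcont : ContinuousOn (fun p : ℝ × Sph n => G p.1 p.2) (Ioi 0 ×ˢ univ))
    (hGdiff : ∀ t, 0 < t → ∀ v, DifferentiableAt ℝ (fun s => G s v) t)
    (hGtcont : ContinuousOn (fun p : ℝ × Sph n => partialT G p.1 p.2) (Ioi 0 ×ˢ univ))
    (hψpos : ∀ t, 0 < t → 0 < ψ t) (hψcont : ContinuousOn ψ (Ioi 0))
    (hφfin : ∀ t, 0 < t → ∫⁻ s in Ioc (0 : ℝ) t, ENNReal.ofReal (ψ s / s) < ⊤)
    (hz : z ∈ constraintSet (phi ψ) lam)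
    (hmin : ∀ z' ∈ constraintSet (phi ψ) lam,
      dualVolume G (polyOf u z) ≤ dualVolume G (polyOf u z'))
    {d : Fin m → ℝ} (hd : ∑ i, lam i * d i = 0) {c : Sph n → ℝ}
    (hc : ∀ᵐ w ∂sphMeas n, ∀ i, w ∈ facetCone u z i → d i = c w) :
    Integrable (fun w => c w * curvDensity G ψ (polyOf u z) w) (sphMeas n) ∧
      ∫ w, c w * curvDensity G ψ (polyOf u z) w ∂sphMeas n = 0 := by
  obtain ⟨ζ, hζ0, hζmem, hζ⟩ := exists_constraintSet_curve hψpos hψcont hφfin hz hd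
  have heq : (fun w => c w * curvDensity G ψ (polyOf u z) w) = fun w =>
      radialFn (polyOf u z) w * partialT G (radialFn (polyOf u z) w) w *
        (c w / ψ (supportFn (polyOf u z) (radialGaussMap (polyOf u z) w))) := by
    funext w
    simp only [curvDensity]
    ring
  rw [heq]
  have h := hasDerivAt_dualVolume_polyOf hu hGcont hGdiff hGtcont hζ0 hz.1 hζ
    (k := fun w => c w / ψ (supportFn (polyOf u z) (radialGaussMap (polyOf u z) w))) (by
      filter_upwards [ae_radialGaussMap_polyOf hu hz.1, hc] with w hw hcw i hi
      have := (hz.1 i).ne'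
      rw [(hw i hi).2, ← hcw i hi]
      field_simp)
  refine ⟨h.1, IsLocalMin.hasDerivAt_eq_zero (hζmem.mono fun s hs => ?_) h.2⟩
  change dualVolume G (polyOf u (ζ 0)) ≤ dualVolume G (polyOf u (ζ s))
  rw [hζ0]
  exact hmin _ hs

/-- At a minimizer no constraint is redundant. If the `i`-th one were, lowering `z_i` slightly would
leave the polytope unchanged, while the constraint set allows all other facets to move outwards in
exchange, and the dual volume would decrease. -/
theorem supportFn_polyOf_of_minimizer (hn : 1 ≤ n) (hlam : ∀ i, 0 < lam i)
    (hu : ∀ v : Sph n, ∃ i, 0 < inner ℝ (v : Eu n) (u i : Eu n))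
    (hGcont : ContinuousOn (fun p : ℝ × Sph n => G p.1 p.2) (Ioi 0 ×ˢ univ))
    (hGdiff : ∀ t, 0 < t → ∀ v, DifferentiableAt ℝ (fun s => G s v) t)
    (hGtcont : ContinuousOn (fun p : ℝ × Sph n => partialT G p.1 p.2) (Ioi 0 ×ˢ univ))
    (hGtneg : ∀ t, 0 < t → ∀ v, partialT G t v < 0)
    (hψpos : ∀ t, 0 < t → 0 < ψ t) (hψcont : ContinuousOn ψ (Ioi 0))
    (hφfin : ∀ t, 0 < t → ∫⁻ s in Ioc (0 : ℝ) t, ENNReal.ofReal (ψ s / s) < ⊤)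
    (hz : z ∈ constraintSet (phi ψ) lam)
    (hmin : ∀ z' ∈ constraintSet (phi ψ) lam,
      dualVolume G (polyOf u z) ≤ dualVolume G (polyOf u z')) (i : Fin m) :
    supportFn (polyOf u z) (u i) = z i := by
  classical
  by_contra hne
  have hempty : ∀ w, w ∉ facetCone u z i := fun w hw =>
    hne (supportFn_polyOf_of_mem_facetCone hu hz.1 hw)
  have hΛ : 0 < ∑ j, lam j := Finset.sum_pos (fun j _ => hlam j) Finset.univ_nonempty
  set c := lam i / ∑ j, lam j
  have hcpos : 0 < c := div_pos (hlam i) hΛ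
  have hd : ∑ j, lam j * (c - if j = i then 1 else 0) = 0 := by
    simp only [mul_sub, Finset.sum_sub_distrib, ← Finset.sum_mul, mul_ite, mul_one, mul_zero,
      Finset.sum_ite_eq', Finset.mem_univ, if_true]
    rw [mul_div_cancel₀ _ hΛ.ne', sub_self]
  have h := integral_eq_zero_of_minimizer hu hGcont hGdiff hGtcont hψpos hψcont hφfin hz hmin hd
    (c := fun _ => c) (Eventually.of_forall fun w j hj => by
      have hji : j ≠ i := fun h => hempty w (h ▸ hj)
      simp [hji])
  refine (integral_neg_of_ae_neg (sphMeas_ne_zero hn) h.1 ?_).ne h.2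
  filter_upwards [ae_psi_supportFn_pos hu hz.1 hψpos] with w hw
  exact mul_neg_of_pos_of_neg hcpos
    (div_neg_of_neg_of_pos (radialFn_mul_partialT_neg hu hz.1 hGtneg w) hw)

/-- The Euler–Lagrange equation in weak form: the image of the curvature density under the Gauss
map is a multiple of the discrete measure with weights `lam`. -/
theorem integral_comp_radialGaussMap_of_minimizer (hlam : ∀ i, 0 < lam i)
    (hu : ∀ v : Sph n, ∃ i, 0 < inner ℝ (v : Eu n) (u i : Eu n))
    (hGcont : ContinuousOn (fun p : ℝ × Sph n => G p.1 p.2) (Ioi 0 ×ˢ univ))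
    (hGdiff : ∀ t, 0 < t → ∀ v, DifferentiableAt ℝ (fun s => G s v) t)
    (hGtcont : ContinuousOn (fun p : ℝ × Sph n => partialT G p.1 p.2) (Ioi 0 ×ˢ univ))
    (hψpos : ∀ t, 0 < t → 0 < ψ t) (hψcont : ContinuousOn ψ (Ioi 0))
    (hφfin : ∀ t, 0 < t → ∫⁻ s in Ioc (0 : ℝ) t, ENNReal.ofReal (ψ s / s) < ⊤)
    (hz : z ∈ constraintSet (phi ψ) lam)
    (hmin : ∀ z' ∈ constraintSet (phi ψ) lam,
      dualVolume G (polyOf u z) ≤ dualVolume G (polyOf u z')) (f : Sph n → ℝ) :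
    (∑ i, lam i) * ∫ w, f (radialGaussMap (polyOf u z) w) * curvDensity G ψ (polyOf u z) w
        ∂sphMeas n
      = (∑ i, lam i * f (u i)) * ∫ w, curvDensity G ψ (polyOf u z) w ∂sphMeas n := by
  have hΛ : 0 < ∑ j, lam j := Finset.sum_pos (fun j _ => hlam j) Finset.univ_nonempty
  set c := (∑ i, lam i * f (u i)) / ∑ j, lam j with hc
  have hcΛ : (∑ j, lam j) * c = ∑ i, lam i * f (u i) := mul_div_cancel₀ _ hΛ.ne'
  have hd : ∑ j, lam j * (f (u j) - c) = 0 := by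
    simp only [mul_sub, Finset.sum_sub_distrib, ← Finset.sum_mul]
    rw [hcΛ, sub_self]
  have h := (integral_eq_zero_of_minimizer hu hGcont hGdiff hGtcont hψpos hψcont hφfin hz hmin hd
    (c := fun w => f (radialGaussMap (polyOf u z) w) - c) (by
      filter_upwards [ae_radialGaussMap_polyOf hu hz.1] with w hw j hj
      rw [(hw j hj).1])).2
  have hint := fun g : Sph n → ℝ => integrable_curvDensity (ψ := ψ) hu hz.1 hGcont hGdiff hGtcont g
  simp only [sub_mul] at h
  rw [integral_sub (hint f) (hint fun _ => c), integral_const_mul, sub_eq_zero] at h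
  rw [h, ← mul_assoc, hcΛ]

theorem curvMeas_polyOf
    (hu : ∀ v : Sph n, ∃ i, 0 < inner ℝ (v : Eu n) (u i : Eu n)) (hz : ∀ i, 0 < z i)
    (E : Set (Sph n)) :
    curvMeas G ψ (polyOf u z) E = 1 / (n : ℝ) * ∫ w,
      E.indicator 1 (radialGaussMap (polyOf u z) w) * curvDensity G ψ (polyOf u z) w
        ∂sphMeas n := by
  have hmeas : MeasurableSet (⋃ i, ⋃ (_ : u i ∈ E), facetCone u z i) :=
    .iUnion fun i => .iUnion fun _ => (isClosed_facetCone i).measurableSet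
  rw [curvMeas, Measure.restrict_congr_set (revRadialSphericalImage_polyOf_ae_eq hu hz E),
    ← integral_indicator hmeas]
  congr 1
  refine integral_congr_ae ?_
  filter_upwards [ae_radialGaussMap_polyOf hu hz] with w hw
  obtain ⟨i, hi⟩ := exists_mem_facetCone u z w
  by_cases hE : u i ∈ E
  · have hmem : w ∈ ⋃ i, ⋃ (_ : u i ∈ E), facetCone u z i := mem_iUnion₂.2 ⟨i, hE, hi⟩
    rw [indicator_of_mem hmem, (hw i hi).1, indicator_of_mem hE]
    simp [curvDensity, (hw i hi).1]
  · have hmem : w ∉ ⋃ i, ⋃ (_ : u i ∈ E), facetCone u z i := fun h => by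
      obtain ⟨j, hjE, hj⟩ := mem_iUnion₂.1 h
      exact hE ((hw i hi).1 ▸ (hw j hj).1 ▸ hjE)
    rw [indicator_of_notMem hmem, (hw i hi).1, indicator_of_notMem hE, zero_mul]

end EulerLagrange

/-! ### Discrete measures and the Orlicz norm -/

section Discrete

variable {n m : ℕ} {u : Fin m → Sph n} {lam : Fin m → ℝ}

theorem integral_sum_smul_dirac (hlam : ∀ i, 0 < lam i) (f : Sph n → ℝ) :
    ∫ w, f w ∂(∑ i, ENNReal.ofReal (lam i) • Measure.dirac (u i)) = ∑ i, lam i * f (u i) := by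
  rw [integral_finsetSum_measure fun i _ =>
    (integrable_dirac (by simp)).smul_measure ENNReal.ofReal_ne_top]
  refine Finset.sum_congr rfl fun i _ => ?_
  rw [integral_smul_measure, integral_dirac, ENNReal.toReal_ofReal (hlam i).le, smul_eq_mul]

theorem real_sum_smul_dirac (hlam : ∀ i, 0 < lam i) {E : Set (Sph n)} (hE : MeasurableSet E) :
    (∑ i, ENNReal.ofReal (lam i) • Measure.dirac (u i)).real E
      = ∑ i, lam i * E.indicator 1 (u i) := by
  rw [← integral_indicator_one hE, integral_sum_smul_dirac hlam]

theorem orliczNorm_eq_one [Nonempty (Fin m)] (hlam : ∀ i, 0 < lam i) {ψ : ℝ → ℝ}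
    (hψpos : ∀ t, 0 < t → 0 < ψ t) (hψcont : ContinuousOn ψ (Ioi 0))
    (hφfin : ∀ t, 0 < t → ∫⁻ s in Ioc (0 : ℝ) t, ENNReal.ofReal (ψ s / s) < ⊤)
    {h : Sph n → ℝ} (hh : (fun i => h (u i)) ∈ constraintSet (phi ψ) lam) :
    orliczNorm (phi ψ) (∑ i, ENNReal.ofReal (lam i) • Measure.dirac (u i)) h = 1 := by
  have hΛ : 0 < ∑ j, lam j := Finset.sum_pos (fun j _ => hlam j) Finset.univ_nonempty
  have hφ1 := phi_pos hψpos hψcont hφfin one_pos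
  have huniv : (∑ i, ENNReal.ofReal (lam i) • Measure.dirac (u i)).real univ = ∑ i, lam i := by
    rw [real_sum_smul_dirac hlam .univ]; simp
  have hcon : ∑ i, lam i * phi ψ (h (u i)) = phi ψ 1 * ∑ i, lam i := by
    rw [hh.2, ← Finset.sum_mul, mul_comm]
  have hpos : 0 < phi ψ 1 * ∑ i, lam i := mul_pos hφ1 hΛ
  refine IsLeast.csInf_eq ⟨⟨one_pos, ?_⟩, ?_⟩
  · rw [huniv, integral_sum_smul_dirac hlam]
    simp only [div_one]
    rw [hcon, one_div, inv_mul_cancel₀ hpos.ne']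
  · rintro l ⟨hl, hle⟩
    by_contra! hl1
    rw [huniv, integral_sum_smul_dirac hlam, one_div, inv_mul_le_iff₀ hpos, mul_one, ← hcon] at hle
    refine hle.not_gt (Finset.sum_lt_sum_of_nonempty Finset.univ_nonempty fun i _ => ?_)
    have hi : 0 < h (u i) := hh.1 i
    refine mul_lt_mul_of_pos_left ?_ (hlam i)
    exact strictMonoOn_phi hψpos hψcont hφfin hi (div_pos hi hl)
      ((lt_div_iff₀ hl).2 (mul_lt_of_lt_one_right hi hl1))

end Discrete

end DualOrlicz

/-! ### The discrete dual Orlicz–Minkowski problem -/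

theorem mainTheorem2 (n m : ℕ) (hn : 1 ≤ n)
    (lam : Fin m → ℝ) (hlam : ∀ i, 0 < lam i)
    (u : Fin m → Sph n) (hu : ∀ v : Sph n, ¬ range u ⊆ closedHemisphere v)
    (μ : Measure (Sph n)) (hμ : μ = ∑ i, ENNReal.ofReal (lam i) • Measure.dirac (u i))
    (G : ℝ → Sph n → ℝ)
    (hGpos : ∀ t, 0 < t → ∀ v, 0 < G t v)
    (hGcont : ContinuousOn (fun p : ℝ × Sph n => G p.1 p.2) (Ioi 0 ×ˢ univ))
    (hGdiff : ∀ t, 0 < t → ∀ v, DifferentiableAt ℝ (fun s => G s v) t)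
    (hGtcont : ContinuousOn (fun p : ℝ × Sph n => partialT G p.1 p.2) (Ioi 0 ×ˢ univ))
    (hGtneg : ∀ t, 0 < t → ∀ v, partialT G t v < 0)
    (ε₀ : ℝ) (hε₀ : 0 < ε₀) (hε₁ : ε₀ < 1)
    (hblow : ∀ v : Sph n,
      Tendsto (fun t : ℝ => ∫ w in cap ε₀ v, G t w ∂(sphMeas n)) (𝓝[>] 0) atTop)
    (ψ : ℝ → ℝ)
    (hψpos : ∀ t, 0 < t → 0 < ψ t)
    (hψcont : ContinuousOn ψ (Ioi 0))
    (hψinf : ∫⁻ s in Ioi (1 : ℝ), ENNReal.ofReal (ψ s / s) = ⊤)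
    (hφfin : ∀ t, 0 < t → ∫⁻ s in Ioc (0 : ℝ) t, ENNReal.ofReal (ψ s / s) < ⊤) :
    ∃ (P : Set (Eu n)) (τ : ℝ),
      IsConvexPolytope P ∧ IsBodyAroundOrigin P ∧ τ < 0 ∧
      (∀ E : Set (Sph n), MeasurableSet E → μ.real E = τ * curvMeas G ψ P E) ∧
      orliczNorm (phi ψ) μ (supportFn P) = 1 ∧
      τ = μ.real univ / curvMeas G ψ P univ ∧
      τ = 1 / curvMeas G (fun _ => 1) P univ * ∫ w, ψ (supportFn P w) ∂μ ∧
      ∃ z ∈ constraintSet (phi ψ) lam, P = polyOf u z ∧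
        ∀ z' ∈ constraintSet (phi ψ) lam,
          dualVolume G (polyOf u z) ≤ dualVolume G (polyOf u z') := by
  subst hμ
  have hspan : ∀ v : Sph n, ∃ i, 0 < inner ℝ (v : Eu n) (u i : Eu n) := by
    intro v
    obtain ⟨_, ⟨i, rfl⟩, hi⟩ := not_subset.1 (hu (-v))
    refine ⟨i, ?_⟩
    simpa [closedHemisphere, real_inner_comm] using hi
  have hne : Nonempty (Fin m) := by
    obtain ⟨i, -⟩ := hspan ⟨EuclideanSpace.single ⟨0, hn⟩ 1, by simp⟩
    exact ⟨i⟩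
  have hn0 : (0 : ℝ) < n := by exact_mod_cast hn
  obtain ⟨z, hz, hmin⟩ := exists_dualVolume_minimizer hlam hspan hGpos hGcont hGdiff hGtneg hε₀
    hblow hψpos hψcont hψinf hφfin
  set P := polyOf u z with hP
  have hΛ : 0 < ∑ i, lam i := Finset.sum_pos (fun i _ => hlam i) Finset.univ_nonempty
  have hEL := integral_comp_radialGaussMap_of_minimizer hlam hspan hGcont hGdiff hGtcont hψpos
    hψcont hφfin hz hmin
  have htight := supportFn_polyOf_of_minimizer hn hlam hspan hGcont hGdiff hGtcont hGtneg hψpos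
    hψcont hφfin hz hmin
  have hψh := ae_psi_supportFn_pos hspan hz.1 hψpos
  rw [← hP] at hEL htight hψh
  set I := ∫ w, curvDensity G ψ P w ∂sphMeas n with hI
  have hIneg : I < 0 := by
    have hint := integrable_curvDensity (ψ := ψ) hspan hz.1 hGcont hGdiff hGtcont fun _ => 1
    simp only [one_mul] at hint
    refine integral_neg_of_ae_neg (sphMeas_ne_zero hn) hint ?_
    filter_upwards [hψh] with w hw
    exact div_neg_of_neg_of_pos (radialFn_mul_partialT_neg hspan hz.1 hGtneg w) hw
  have hCuniv : curvMeas G ψ P univ = 1 / (n : ℝ) * I := by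
    rw [hP, curvMeas_polyOf hspan hz.1, ← hP]; simp [hI]
  have hCneg : curvMeas G ψ P univ < 0 := by
    rw [hCuniv]; exact mul_neg_of_pos_of_neg (by positivity) hIneg
  have huniv : (∑ i, ENNReal.ofReal (lam i) • Measure.dirac (u i)).real univ = ∑ i, lam i := by
    rw [real_sum_smul_dirac hlam .univ]; simp
  refine ⟨P, (∑ i, lam i) / curvMeas G ψ P univ, isConvexPolytope_polyOf hspan hz.1,
    isBodyAroundOrigin_polyOf hspan hz.1, div_neg_of_pos_of_neg hΛ hCneg, fun E hE => ?_, ?_,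
    by rw [huniv], ?_, z, hz, rfl, hmin⟩
  · have h := hEL (E.indicator 1)
    rw [real_sum_smul_dirac hlam hE, hCuniv, hP, curvMeas_polyOf hspan hz.1, ← hP,
      div_mul_eq_mul_div, eq_div_iff (mul_neg_of_pos_of_neg (by positivity) hIneg).ne]
    linear_combination -(1 / (n : ℝ)) * h
  · refine orliczNorm_eq_one hlam hψpos hψcont hφfin ?_
    simpa only [htight] using hz
  · have hJ : curvMeas G (fun _ => 1) P univ = 1 / (n : ℝ) *
        ∫ w, ψ (supportFn P (radialGaussMap P w)) * curvDensity G ψ P w ∂sphMeas n := by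
      rw [hP, curvMeas_polyOf hspan hz.1, ← hP]
      congr 1
      refine integral_congr_ae ?_
      filter_upwards [hψh] with w hw
      simp only [curvDensity, indicator_univ, Pi.one_apply, one_mul, div_one]
      rw [mul_div_cancel₀ _ hw.ne']
    have h := hEL fun v => ψ (supportFn P v)
    have hS : 0 < ∑ i, lam i * ψ (supportFn P (u i)) :=
      Finset.sum_pos (fun i _ => mul_pos (hlam i) (by rw [htight]; exact hψpos _ (hz.1 i)))
        Finset.univ_nonempty
    have hJne : ∫ w, ψ (supportFn P (radialGaussMap P w)) * curvDensity G ψ P w ∂sphMeas n ≠ 0 :=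
      right_ne_zero_of_mul (h.trans_ne (mul_ne_zero hS.ne' hIneg.ne))
    rw [integral_sum_smul_dirac hlam, hJ, hCuniv]
    have hI0 := hIneg.ne
    field_simp
    linear_combination h
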